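/- Let $M$ be a smooth manifold and let $(\mathcal{A},[\cdot,\cdot],\rho)$ be a Lie algebroid over $M$: a smooth vector bundle of finite rank with an $\mathbb{R}$-Lie bracket on $\Gamma(\mathcal{A})$ and a smooth vector bundle morphism $\rho:\mathcal{A}\to TM$ such that $[X,fY]=f[X,Y]+(\rho(X)f)Y$. For a vector bundle $E$ over $M$ put $\Omega^k(\mathcal{A},E)=\Gamma(\wedge^k\mathcal{A}^*\otimes E)$ and $\Omega^k(\mathcal{A})=\Omega^k(\mathcal{A},M\times\mathbb{R})$. Let $\mathrm{Sh}_{p,k}$ be the set of permutations of $\{1,\dots,p+k\}$ increasing on the first $p$ and on the last $k$ letters. For $\phi\in\Omega^p(\mathcal{A},\mathcal{A})$ and $\psi\in\Omega^{k+1}(\mathcal{A},E)$ let $$(i_\phi\psi)(Z_1,\dots,Z_{p+k})=\sum_{\sigma\in \mathrm{Sh}_{p,k}}(-1)^\sigma\,\psi\bigl(\phi(Z_{\sigma(1)},\dots,Z_{\sigma(p)}),Z_{\sigma(p+1)},\dots,Z_{\sigma(p+k)}\bigr),$$ and $i_\phi=0$ on $\Omega^0(\mathcal{A},E)$. An $\mathcal{A}$-connection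 on $E$ is a map $\nabla:\Gamma(\mathcal{A})\times\Gamma(E)\to\Gamma(E)$, $\mathcal{C}^\infty(M)$-linear in the first and $\mathbb{R}$-linear in the second argument, with $\nabla_X(fs)=(\rho(X)f)s+f\nabla_Xs$; its covariant exterior derivative is, for $\phi\in\Omega^p(\mathcal{A},E)$, $$(d^\nabla\phi)(Z_1,\dots,Z_{p+1})=\sum_{\sigma\in \mathrm{Sh}_{1,p}}(-1)^\sigma\nabla_{Z_{\sigma(1)}}\bigl(\phi(Z_{\sigma(2)},\dots,Z_{\sigma(p+1)})\bigr)-\sum_{\sigma\in \mathrm{Sh}_{2,p-1}}(-1)^\sigma\phi\bigl([Z_{\sigma(1)},Z_{\sigma(2)}],Z_{\sigma(3)},\dots,Z_{\sigma(p+1)}\bigr).$$ For $\phi\in\Omega^k(\mathcal{A},\mathcal{A})$ the covariant Lie derivative is $\mathcal{L}^\nabla_\phi=[i_\phi,d^\nabla]=i_\phi d^\nabla+(-1)^kd^\nabla i_\phi$, where $[S,T]=ST-(-1)^{ab}TS$ denotes the graded commutator of operators of degrees $a$ and $b$. On $\Omega^*(\mathcal{A})$ let $\mathcal{L}_\phi$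 denote $\mathcal{L}^{\nabla^\rho}_\phi$ for the connection $\nabla^\rho_Xf=\rho(X)f$ on $M\times\mathbb{R}$. The Frölicher–Nijenhuis bracket of $\phi\in\Omega^k(\mathcal{A},\mathcal{A})$ and $\psi\in\Omega^l(\mathcal{A},\mathcal{A})$ is the form $[\phi,\psi]_{FN}\in\Omega^{k+l}(\mathcal{A},\mathcal{A})$ characterized by the equality of operators on $\Omega^*(\mathcal{A})$ $$[\mathcal{L}_\phi,i_\psi]=i_{[\phi,\psi]_{FN}}-(-1)^{k(l-1)}\mathcal{L}_{i_\psi\phi}.$$ **Theorem.** Let $\phi\in\Omega^k(\mathcal{A},\mathcal{A})$ and $\psi\in\Omega^l(\mathcal{A},\mathcal{A})$, and let $\nabla$ be a torsion-free $\mathcal{A}$-connection on $\mathcal{A}$, i.e. $\nabla_XY-\nabla_YX=[X,Y]$ for all $X,Y\in\Gamma(\mathcal{A})$. Then there is exactly one form in $\Omega^{k+l}(\mathcal{A},\mathcal{A})$ with the characterizing property of $[\phi,\psi]_{FN}$, and $$[\phi,\psi]_{FN}=\mathcal{L}^\nabla_\phi\psi-(-1)^{kl}\mathcal{L}^\nabla_\psi\phi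 .$$ -/

import Mathlib

open scoped Manifold ContDiff
open Bundle

noncomputable section

namespace LieAlgd

/-- The space `Γ(V)` of smooth sections of a vector bundle `V → M` with model fibre `F`. -/
abbrev Sec {E : Type*} [NormedAddCommGroup E] [NormedSpace ℝ E]
    {H : Type*} [TopologicalSpace H] (I : ModelWithCorners ℝ E H)
    {M : Type*} [TopologicalSpace M] [ChartedSpace H M]
    (F : Type*) [NormedAddCommGroup F] [NormedSpace ℝ F]
    (V : M → Type*) [TopologicalSpace (TotalSpace F V)] [∀ x, TopologicalSpace (V x)]
    [FiberBundle F V] : Type _ :=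
  ContMDiffSection I F ∞ V

section Basic

variable {E : Type*} [NormedAddCommGroup E] [NormedSpace ℝ E]
  {H : Type*} [TopologicalSpace H] {I : ModelWithCorners ℝ E H}
  {M : Type*} [TopologicalSpace M] [ChartedSpace H M]
  {F : Type*} [NormedAddCommGroup F] [NormedSpace ℝ F]
  {V : M → Type*} [TopologicalSpace (TotalSpace F V)] [∀ x, TopologicalSpace (V x)]
  [FiberBundle F V] [∀ x, AddCommGroup (V x)] [∀ x, Module ℝ (V x)] [VectorBundle ℝ F V]

/-- The product `f s` of a smooth function and a smooth section. -/
def fsmul (f : C^∞⟮I, M; ℝ⟯) (s : Sec I F V) : Sec I F V :=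
  ⟨fun x => f x • s x, f.contMDiff.smul_section s.contMDiff⟩

/-- A smooth function on `M`, regarded as a section of the trivial line bundle `M × ℝ`. -/
def ofFun (f : C^∞⟮I, M; ℝ⟯) : Sec I ℝ (Trivial M ℝ) :=
  ⟨fun x => f x, fun x => (contMDiffAt_section x).2 (f.contMDiff x)⟩

/-- A section of the trivial line bundle `M × ℝ`, regarded as a smooth function on `M`. -/
def asFun (s : Sec I ℝ (Trivial M ℝ)) : C^∞⟮I, M; ℝ⟯ :=
  ⟨fun x => s x, fun x => (contMDiffAt_section x).1 (s.contMDiff x)⟩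

/-- The derivative `x ↦ (d f)_x (ρ_x (X_x))` of a smooth function `f` along the image of a section
`X` of `V` under a smooth vector bundle morphism `ρ : V → TM`. -/
def derivAlong [IsManifold I ∞ M] (ρ : ∀ x, V x →ₗ[ℝ] TangentSpace I x)
    (hρ : ContMDiff (I.prod 𝓘(ℝ, F)) I.tangent ∞
      (fun v : TotalSpace F V => (⟨v.proj, ρ v.proj v.2⟩ : TangentBundle I M)))
    (X : Sec I F V) (f : C^∞⟮I, M; ℝ⟯) : C^∞⟮I, M; ℝ⟯ :=
  ⟨fun x => mvfderiv I f x (ρ x (X x)), by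
    have h1 : ContMDiff I I.tangent ∞ (fun x => (⟨x, ρ x (X x)⟩ : TangentBundle I M)) :=
      hρ.comp X.contMDiff
    have h2 : ContMDiff I.tangent 𝓘(ℝ, ℝ).tangent ∞ (tangentMap I 𝓘(ℝ, ℝ) f) :=
      f.contMDiff.contMDiff_tangentMap (by simp)
    exact (contMDiff_snd_tangentBundle_modelSpace ℝ 𝓘(ℝ, ℝ)).comp (h2.comp h1)⟩

end Basic

/-- A Lie algebroid structure on a smooth vector bundle `V → M`. -/
structure LieAlgebroid {E : Type*} [NormedAddCommGroup E] [NormedSpace ℝ E]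
    {H : Type*} [TopologicalSpace H] (I : ModelWithCorners ℝ E H)
    {M : Type*} [TopologicalSpace M] [ChartedSpace H M] [IsManifold I ∞ M]
    (F : Type*) [NormedAddCommGroup F] [NormedSpace ℝ F]
    (V : M → Type*) [TopologicalSpace (TotalSpace F V)] [∀ x, TopologicalSpace (V x)]
    [FiberBundle F V] [∀ x, AddCommGroup (V x)] [∀ x, Module ℝ (V x)] [VectorBundle ℝ F V] where
  /-- the Lie bracket on sections -/
  bracket : Sec I F V →ₗ[ℝ] Sec I F V →ₗ[ℝ] Sec I F V
  bracket_self : ∀ X, bracket X X = 0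
  jacobi : ∀ X Y Z,
    bracket X (bracket Y Z) + bracket Y (bracket Z X) + bracket Z (bracket X Y) = 0
  /-- the anchor, a smooth morphism of vector bundles `V → TM` -/
  anchor : ∀ x, V x →ₗ[ℝ] TangentSpace I x
  anchor_smooth : ContMDiff (I.prod 𝓘(ℝ, F)) I.tangent ∞
    (fun v : TotalSpace F V => (⟨v.proj, anchor v.proj v.2⟩ : TangentBundle I M))
  leibniz : ∀ (X Y : Sec I F V) (f : C^∞⟮I, M; ℝ⟯),
    bracket X (fsmul f Y) =
      fsmul f (bracket X Y) + fsmul (derivAlong anchor anchor_smooth X f) Y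

section Calculus

variable {E : Type*} [NormedAddCommGroup E] [NormedSpace ℝ E]
  {H : Type*} [TopologicalSpace H] {I : ModelWithCorners ℝ E H}
  {M : Type*} [TopologicalSpace M] [ChartedSpace H M] [IsManifold I ∞ M]
  {F : Type*} [NormedAddCommGroup F] [NormedSpace ℝ F]
  {V : M → Type*} [TopologicalSpace (TotalSpace F V)] [∀ x, TopologicalSpace (V x)]
  [FiberBundle F V] [∀ x, AddCommGroup (V x)] [∀ x, Module ℝ (V x)] [VectorBundle ℝ F V]

/-- `ρ(X) f`, for a section `X` of the algebroid and a smooth function `f`. -/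
def LieAlgebroid.rho (A : LieAlgebroid I F V) (X : Sec I F V) (f : C^∞⟮I, M; ℝ⟯) : C^∞⟮I, M; ℝ⟯ :=
  derivAlong A.anchor A.anchor_smooth X f

/-- An `A`-connection on a vector bundle `W` with model fibre `G`. -/
structure Connection (A : LieAlgebroid I F V)
    (G : Type*) [NormedAddCommGroup G] [NormedSpace ℝ G]
    (W : M → Type*) [TopologicalSpace (TotalSpace G W)] [∀ x, TopologicalSpace (W x)]
    [FiberBundle G W] [∀ x, AddCommGroup (W x)] [∀ x, Module ℝ (W x)] [VectorBundle ℝ G W] where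
  /-- `X ↦ ∇_X`, where each `∇_X` is an `ℝ`-linear endomorphism of `Γ(W)` -/
  nabla : Sec I F V → Sec I G W →ₗ[ℝ] Sec I G W
  add_left : ∀ X Y s, nabla (X + Y) s = nabla X s + nabla Y s
  fsmul_left : ∀ (f : C^∞⟮I, M; ℝ⟯) X s, nabla (fsmul f X) s = fsmul f (nabla X s)
  leibniz : ∀ X (f : C^∞⟮I, M; ℝ⟯) s,
    nabla X (fsmul f s) = fsmul (A.rho X f) s + fsmul f (nabla X s)

/-- An `A`-connection on the algebroid itself is torsion-free if `∇_X Y - ∇_Y X = [X, Y]`. -/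
def Connection.TorsionFree {A : LieAlgebroid I F V} (D : Connection A F V) : Prop :=
  ∀ X Y, D.nabla X Y - D.nabla Y X = A.bracket X Y

/-- The connection `∇^ρ_X f = ρ(X) f` on the trivial line bundle. -/
def Connection.ofAnchor (A : LieAlgebroid I F V) : Connection A ℝ (Trivial M ℝ) where
  nabla X :=
    { toFun := fun s => ofFun (A.rho X (asFun s))
      map_add' := fun s t => by
        ext x
        exact congrArg (fun L => L (A.anchor x (X x)))
          (mvfderiv_add (I := I) ((asFun s).mdifferentiableAt (x := x))
            ((asFun t).mdifferentiableAt (x := x)))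
      map_smul' := fun c s => by
        ext x
        have h := mvfderiv_smul (I := I) (mdifferentiableAt_const (c := c) (x := x))
          ((asFun s).mdifferentiableAt (x := x))
        rw [mvfderiv_const] at h
        refine (congrArg (fun L => L (A.anchor x (X x))) h).trans ?_
        rw [ContinuousLinearMap.zero_smulRight, add_zero]
        rfl }
  add_left X Y s := by
    ext x
    exact (congrArg (mvfderiv I (asFun s) x) (map_add (A.anchor x) (X x) (Y x))).trans
      (map_add (mvfderiv I (asFun s) x) _ _)
  fsmul_left f X s := by
    ext x
    exact (congrArg (mvfderiv I (asFun s) x) (map_smul (A.anchor x) (f x) (X x))).trans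
      (map_smul (mvfderiv I (asFun s) x) (f x) _)
  leibniz X f s := by
    ext x
    have h := mvfderiv_smul (I := I) (f.mdifferentiableAt (x := x))
      ((asFun s).mdifferentiableAt (x := x))
    refine (congrArg (fun L => L (A.anchor x (X x))) h).trans ?_
    exact add_comm _ _

/-- The space `Ω^k(A, W) = Γ(Λ^k V^* ⊗ W)` of `W`-valued `k`-forms: families of alternating
`k`-linear maps `V_x × ⋯ × V_x → W_x`, depending smoothly on `x` (i.e. taking smooth sections to
smooth sections). -/
@[ext]
structure Form (I : ModelWithCorners ℝ E H)
    (F : Type*) [NormedAddCommGroup F] [NormedSpace ℝ F]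
    (V : M → Type*) [TopologicalSpace (TotalSpace F V)] [∀ x, TopologicalSpace (V x)]
    [FiberBundle F V] [∀ x, AddCommGroup (V x)] [∀ x, Module ℝ (V x)]
    (G : Type*) [NormedAddCommGroup G] [NormedSpace ℝ G]
    (W : M → Type*) [TopologicalSpace (TotalSpace G W)] [∀ x, TopologicalSpace (W x)]
    [FiberBundle G W] [∀ x, AddCommGroup (W x)] [∀ x, Module ℝ (W x)] (k : ℕ) where
  /-- the alternating map on the fibre over `x` -/
  toFun : ∀ x, V x [⋀^Fin k]→ₗ[ℝ] W x
  smooth : ∀ Z : Fin k → Sec I F V,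
    ContMDiff I (I.prod 𝓘(ℝ, G)) ∞ (fun x => TotalSpace.mk' G x (toFun x (fun i => Z i x)))

variable {G : Type*} [NormedAddCommGroup G] [NormedSpace ℝ G]
  {W : M → Type*} [TopologicalSpace (TotalSpace G W)] [∀ x, TopologicalSpace (W x)]
  [FiberBundle G W] [∀ x, AddCommGroup (W x)] [∀ x, Module ℝ (W x)] [VectorBundle ℝ G W]

instance (k : ℕ) : Zero (Form I F V G W k) :=
  ⟨⟨fun _ => 0, fun _ => (contMDiff_zeroSection ℝ W).of_le le_top⟩⟩

variable (I F V G W) in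
/-- Arbitrary `k`-cochains: maps `Γ(V) × ⋯ × Γ(V) → Γ(W)`. A form is identified with the cochain
which evaluates it on sections. -/
abbrev Cochain (k : ℕ) : Type _ := (Fin k → Sec I F V) → Sec I G W

variable (I F V G W) in
/-- Graded cochains, containing `Ω^*(A, W)`, on which all the operators below act. -/
abbrev Cochains : Type _ := (k : ℕ) → Cochain I F V G W k

/-- The evaluation of a form on sections. -/
def Form.eval {k : ℕ} (φ : Form I F V G W k) : Cochain I F V G W k :=
  fun Z => ⟨fun x => φ.toFun x (fun i => Z i x), φ.smooth Z⟩

/-- A `k`-form as a homogeneous element of degree `k`. -/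
def Form.toCochains {k : ℕ} (φ : Form I F V G W k) : Cochains I F V G W :=
  Pi.single k φ.eval

/-- The `(p, m - p)`-shuffles: the permutations of `m` letters which are increasing on the first `p`
letters and on the remaining ones. -/
def shuffles (p m : ℕ) : Finset (Equiv.Perm (Fin m)) :=
  open scoped Classical in
  Finset.univ.filter fun σ =>
    StrictMonoOn σ {i | (i : ℕ) < p} ∧ StrictMonoOn σ {i | p ≤ (i : ℕ)}

/-- The operator `i_φ` for `φ` of degree `p` with values in `V`. Its component of degree `m = p + k`
is obtained from the component of degree `k + 1` of the argument; it vanishes in degrees `m < p`. -/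
def ins {p : ℕ} (φ : Cochain I F V F V p) (ψ : Cochains I F V G W) : Cochains I F V G W :=
  fun m Z =>
    if h : p ≤ m then
      ∑ σ ∈ shuffles p m, Equiv.Perm.sign σ •
        ψ (m - p + 1) (Fin.cons (φ fun i : Fin p => Z (σ ⟨i, by omega⟩))
          fun j : Fin (m - p) => Z (σ ⟨p + j, by omega⟩))
    else 0

/-- The covariant exterior derivative `d^∇`. On degree `0` it is `(d^∇ s)(Z) = ∇_Z s`. -/
def extDer {A : LieAlgebroid I F V} (D : Connection A G W) (ψ : Cochains I F V G W) :
    Cochains I F V G W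
  | 0 => fun _ => 0
  | 1 => fun Z => D.nabla (Z 0) (ψ 0 Fin.elim0)
  | p + 2 => fun Z =>
      (∑ σ ∈ shuffles 1 (p + 2), Equiv.Perm.sign σ •
        D.nabla (Z (σ 0)) (ψ (p + 1) fun i => Z (σ i.succ)))
      - (∑ σ ∈ shuffles 2 (p + 2), Equiv.Perm.sign σ •
        ψ (p + 1) (Fin.cons (A.bracket (Z (σ 0)) (Z (σ 1))) fun i : Fin p => Z (σ i.succ.succ)))

/-- The graded commutator `[S, T] = S T - (-1)^{ab} T S` of operators of degrees `a` and `b`. -/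
def gradedComm (a b : ℤ) (S T : Cochains I F V G W → Cochains I F V G W) :
    Cochains I F V G W → Cochains I F V G W :=
  fun α => S (T α) - (a * b).negOnePow • T (S α)

/-- The covariant Lie derivative `L^∇_φ = [i_φ, d^∇]` for `φ` of degree `k`; here `i_φ` has degree
`k - 1` and `d^∇` has degree `1`. -/
def covLie {A : LieAlgebroid I F V} (D : Connection A G W) {k : ℕ} (φ : Cochain I F V F V k) :
    Cochains I F V G W → Cochains I F V G W :=
  gradedComm ((k : ℤ) - 1) 1 (ins φ) (extDer D)

/-- `χ` is a Frölicher–Nijenhuis bracket of `φ` and `ψ` if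
`[L_φ, i_ψ] = i_χ - (-1)^{k(l-1)} L_{i_ψ φ}` as operators on `Ω^*(A)`. Here `i_ψ φ` is homogeneous
of degree `k + l - 1`; it is zero if `k = 0`. -/
def IsFNBracket (A : LieAlgebroid I F V) {k l : ℕ} (φ : Form I F V F V k) (ψ : Form I F V F V l)
    (χ : Form I F V F V (k + l)) : Prop :=
  ∀ (q : ℕ) (α : Form I F V ℝ (Trivial M ℝ) q),
    gradedComm (k : ℤ) ((l : ℤ) - 1) (covLie (Connection.ofAnchor A) φ.eval) (ins ψ.eval)
        α.toCochains =
      ins χ.eval α.toCochains -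
        ((k : ℤ) * ((l : ℤ) - 1)).negOnePow •
          covLie (Connection.ofAnchor A) (ins ψ.eval φ.toCochains (k + l - 1)) α.toCochains

open scoped Classical in
/-- The Frölicher–Nijenhuis bracket `[φ, ψ]_FN` of `φ` and `ψ`: the form characterized by
`IsFNBracket` (and `0` if there were none). -/
def fnBracket (A : LieAlgebroid I F V) {k l : ℕ} (φ : Form I F V F V k) (ψ : Form I F V F V l) :
    Form I F V F V (k + l) :=
  if h : ∃ χ, IsFNBracket A φ ψ χ then h.choose else 0

end Calculus

end LieAlgd

end

/-!
The Frölicher–Nijenhuis bracket is computed through the covariant derivative `∇_φ` along a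
vector-valued form `φ = ∑ φ^i ⊗ e_i`, which is `∇_φ α = ∑ φ^i ∧ ∇_{e_i} α`. If `∇` is torsion-free,
then `d^∇ = ∇_{id}`. The insertion operators satisfy

* `[∇_φ, i_ψ] = i_{∇_φ ψ} - (-1)^{k(l-1)} ∇_{i_ψ φ}` (`covDerAlong_insC`),
* `[i_φ, i_ψ] = i_{i_φ ψ} - (-1)^{(k-1)(l-1)} i_{i_ψ φ}` (`IsTensorial.insC_insC`).

The first relation with `id` in place of `φ` gives `L_φ = ∇_φ + (-1)^k i_{d^∇ φ}` (`lieC_eq`), both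
on scalar forms and on forms with values in the algebroid. Inserting this decomposition into
`[L_φ, i_ψ]` and applying the two relations yields `[L_φ, i_ψ] = i_χ - (-1)^{k(l-1)} L_{i_ψ φ}` with
`χ = L^∇_φ ψ - (-1)^{kl} L^∇_ψ φ` (`lieC_insC`). Neither the curvature nor the Jacobi identity
plays a role.

The signs and shuffles are handled by the product `φ ⊼ β` of a `P`-valued cochain `φ` with a family
`β : P → cochains`, standing for `∑ φ^i ∧ β (e_i)`. Both `i_φ α = φ ⊼ (X ↦ ι_X α)` and
`∇_φ α = φ ⊼ (X ↦ ∇_X α)` are of this kind. The product is defined by the Leibniz rule for the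
contractions `ι_X`, and the two relations rest on its associativity (`wedge_assoc`) and graded
commutativity (`wedge_swap`), which are inductions on the degree, and on `ι_X ι_Y = -ι_Y ι_X`. That
the product is given by the usual sum over shuffles is `wedge_single`.

For existence, the cochain `χ` is shown to be multilinear over the smooth functions and alternating,
hence a form, by tensoriality (`exists_form_eval_eq`). For uniqueness, `i_χ α = α ∘ χ` on `1`-forms,
and `1`-forms separate the points of the fibres (`Form.eq_of_ins_eq`).
-/

noncomputable section

namespace LieAlgd

/-! ### Graded cochains on an additive group -/

section GradedCochains

/-- Inhomogeneous cochains on `L` with values in `N`: one arbitrary function of `k` variables for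
each `k`. Forms of degree `k` are the elements `Pi.single k _`; working with the whole family at
once avoids all casts between degrees. -/
abbrev Multi (L N : Type*) : Type _ := (k : ℕ) → (Fin k → L) → N

variable {L N N' P Q : Type*}

/-- The contraction `ι_X α`, which inserts `X` into the first slot. -/
def contr (X : L) (α : Multi L N) : Multi L N := fun k Z => α (k + 1) (Fin.cons X Z)

/-- The post-composition of a cochain with a map of the values. -/
def mapC (T : N → N') (α : Multi L N) : Multi L N' := fun k Z => T (α k Z)

theorem succ_eq_contr (α : Multi L N) (m : ℕ) (Z : Fin (m + 1) → L) :
    α (m + 1) Z = contr (Z 0) α m (Fin.tail Z) := by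
  rw [contr, Fin.cons_self_tail]

@[simp] theorem contr_mapC (X : L) (T : N → N') (α : Multi L N) :
    contr X (mapC T α) = mapC T (contr X α) := rfl

variable [AddCommGroup N] [AddCommGroup N'] [AddCommGroup P] [AddCommGroup Q]

/-- The grading involution, `(-1)^k` in degree `k`. -/
def gradeInv (α : Multi L N) : Multi L N := fun k Z => (-1 : ℤ) ^ k • α k Z

/-- The cochain of degree `0` given by `x`. -/
def deg0 (x : N) : Multi L N := Pi.single 0 fun _ => x

/-- The cochain of degree `1` given by `S`. -/
def deg1 (S : L → N) : Multi L N := Pi.single 1 fun Z => S (Z 0)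

@[simp] theorem contr_zero (X : L) : contr X (0 : Multi L N) = 0 := rfl
@[simp] theorem contr_add (X : L) (α β : Multi L N) : contr X (α + β) = contr X α + contr X β := rfl
@[simp] theorem contr_sub (X : L) (α β : Multi L N) : contr X (α - β) = contr X α - contr X β := rfl
@[simp] theorem contr_neg (X : L) (α : Multi L N) : contr X (-α) = -contr X α := rfl
@[simp] theorem contr_zsmul (X : L) (n : ℤ) (α : Multi L N) :
    contr X (n • α) = n • contr X α := rfl

@[simp] theorem contr_gradeInv (X : L) (α : Multi L N) :
    contr X (gradeInv α) = -gradeInv (contr X α) := by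
  funext k Z
  simp [contr, gradeInv, pow_succ]

@[simp] theorem gradeInv_gradeInv (α : Multi L N) : gradeInv (gradeInv α) = α := by
  funext k Z
  rcases neg_one_pow_eq_or ℤ k with h | h <;> simp [gradeInv, h]

@[simp] theorem gradeInv_zero : gradeInv (0 : Multi L N) = 0 := by
  funext k Z; simp [gradeInv]

theorem gradeInv_add (α β : Multi L N) : gradeInv (α + β) = gradeInv α + gradeInv β := by
  funext k Z; simp [gradeInv]

theorem mapC_add (T : N →+ N') (α β : Multi L N) : mapC T (α + β) = mapC T α + mapC T β := by
  funext k Z; simp [mapC]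

theorem mapC_sub (T : N →+ N') (α β : Multi L N) : mapC T (α - β) = mapC T α - mapC T β := by
  funext k Z; simp [mapC]

theorem deg1_add (S T : L → N) : deg1 (S + T) = deg1 S + deg1 T := by
  rw [deg1, deg1, deg1, ← Pi.single_add]; rfl

theorem gradeInv_single (k : ℕ) (φ : (Fin k → L) → N) :
    gradeInv (Pi.single k φ : Multi L N) = (-1 : ℤ) ^ k • Pi.single k φ := by
  funext m Z
  rcases eq_or_ne m k with rfl | h
  · simp [gradeInv]
  · simp [gradeInv, Pi.single_eq_of_ne h]

@[simp] theorem gradeInv_deg0 (x : N) : gradeInv (deg0 x : Multi L N) = deg0 x := by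
  simpa [deg0] using gradeInv_single (L := L) 0 fun _ => x

@[simp] theorem gradeInv_deg1 (S : L → N) : gradeInv (deg1 S) = -deg1 S := by
  simpa [deg1] using gradeInv_single (L := L) 1 fun Z => S (Z 0)

theorem contr_single_succ (X : L) (k : ℕ) (φ : (Fin (k + 1) → L) → N) :
    contr X (Pi.single (k + 1) φ : Multi L N) = Pi.single k fun Z => φ (Fin.cons X Z) := by
  funext m Z
  rcases eq_or_ne m k with rfl | h
  · simp [contr]
  · have h' : m + 1 ≠ k + 1 := by omega
    simp [contr, Pi.single_eq_of_ne h, Pi.single_eq_of_ne h']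

theorem contr_single_zero (X : L) (φ : (Fin 0 → L) → N) :
    contr X (Pi.single 0 φ : Multi L N) = 0 := by
  funext m Z
  simp [contr]

@[simp] theorem contr_deg0 (X : L) (x : N) : contr X (deg0 x) = 0 := contr_single_zero X _

@[simp] theorem contr_deg1 (X : L) (S : L → N) : contr X (deg1 S) = deg0 (S X) := by
  simp [deg1, contr_single_succ, deg0]

/-! ### The wedge product of a cochain with a family of cochains -/

/-- The recursion behind `wedge`. -/
def wedgeAt {P : Type*} [AddCommGroup P] :
    (m : ℕ) → Multi L P → (P → Multi L N) → (Fin m → L) → N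
  | 0, φ, β, Z => β (φ 0 Z) 0 Z
  | m + 1, φ, β, Z => wedgeAt m (contr (Z 0) φ) β (Fin.tail Z)
      + wedgeAt m (gradeInv φ) (fun x => contr (Z 0) (β x)) (Fin.tail Z)

/-- The wedge product `φ ⊼ β` of a `P`-valued cochain with an additive family `β : P → Multi L N`:
for `φ = ∑ φ^i ⊗ e_i` it is `∑ φ^i ∧ β (e_i)`. It is defined by the Leibniz rule
`ι_X (φ ⊼ β) = ι_X φ ⊼ β + (-1)^{deg φ} φ ⊼ ι_X β`, so that identities follow by induction on the
degree, without shuffles. -/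
def wedge (φ : Multi L P) (β : P → Multi L N) : Multi L N := fun m Z => wedgeAt m φ β Z

scoped infixl:75 " ⊼ " => wedge

theorem wedge_apply_zero (φ : Multi L P) (β : P → Multi L N) (Z : Fin 0 → L) :
    (φ ⊼ β) 0 Z = β (φ 0 Z) 0 Z := rfl

theorem contr_wedge (X : L) (φ : Multi L P) (β : P → Multi L N) :
    contr X (φ ⊼ β) = contr X φ ⊼ β + gradeInv φ ⊼ fun x => contr X (β x) := by
  funext m Z
  simp [contr, wedge, wedgeAt, Fin.tail_cons]

theorem wedge_apply_succ (φ : Multi L P) (β : P → Multi L N) (m : ℕ) (Z : Fin (m + 1) → L) :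
    (φ ⊼ β) (m + 1) Z = (contr (Z 0) φ ⊼ β) m (Fin.tail Z)
      + (gradeInv φ ⊼ fun x => contr (Z 0) (β x)) m (Fin.tail Z) := rfl

theorem add_wedge (φ φ' : Multi L P) {β : P → Multi L N} (hβ : ∀ x y, β (x + y) = β x + β y) :
    (φ + φ') ⊼ β = φ ⊼ β + φ' ⊼ β := by
  funext m Z
  induction m generalizing φ φ' β with
  | zero => simp [wedge_apply_zero, hβ]
  | succ m ih =>
    simp only [wedge_apply_succ, contr_add, gradeInv_add, Pi.add_apply, ih _ _ hβ,
      ih _ _ (β := fun x => contr (Z 0) (β x)) fun x y => by rw [hβ, contr_add]]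
    abel

/-- `wedge` as an additive map in its first argument. -/
def wedgeHom (β : P → Multi L N) (hβ : ∀ x y, β (x + y) = β x + β y) : Multi L P →+ Multi L N :=
  AddMonoidHom.mk' (fun φ => φ ⊼ β) fun φ φ' => add_wedge φ φ' hβ

theorem zsmul_wedge (n : ℤ) (φ : Multi L P) {β : P → Multi L N}
    (hβ : ∀ x y, β (x + y) = β x + β y) : (n • φ) ⊼ β = n • (φ ⊼ β) :=
  map_zsmul (wedgeHom β hβ) n φ

theorem neg_wedge (φ : Multi L P) {β : P → Multi L N}
    (hβ : ∀ x y, β (x + y) = β x + β y) : (-φ) ⊼ β = -(φ ⊼ β) :=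
  map_neg (wedgeHom β hβ) φ

theorem sub_wedge (φ φ' : Multi L P) {β : P → Multi L N}
    (hβ : ∀ x y, β (x + y) = β x + β y) : (φ - φ') ⊼ β = φ ⊼ β - φ' ⊼ β :=
  map_sub (wedgeHom β hβ) φ φ'

theorem zero_wedge {β : P → Multi L N} (h0 : β 0 = 0) : (0 : Multi L P) ⊼ β = 0 := by
  funext m Z
  induction m generalizing β with
  | zero => simp [wedge_apply_zero, h0]
  | succ m ih =>
    rw [wedge_apply_succ, contr_zero, gradeInv_zero, ih h0, ih (by simp [h0])]
    simp

theorem wedge_add (φ : Multi L P) (β β' : P → Multi L N) :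
    (φ ⊼ fun x => β x + β' x) = φ ⊼ β + φ ⊼ β' := by
  funext m Z
  induction m generalizing φ β β' with
  | zero => simp [wedge_apply_zero]
  | succ m ih =>
    simp only [wedge_apply_succ, contr_add, Pi.add_apply, ih]
    abel

theorem wedge_mapC (T : N →+ N') (φ : Multi L P) (β : P → Multi L N) :
    (φ ⊼ fun x => mapC T (β x)) = mapC T (φ ⊼ β) := by
  funext m Z
  induction m generalizing φ β with
  | zero => simp [wedge_apply_zero, mapC]
  | succ m ih => simp only [wedge_apply_succ, contr_mapC, ih, mapC, map_add]

theorem wedge_zsmul (n : ℤ) (φ : Multi L P) (β : P → Multi L N) :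
    (φ ⊼ fun x => n • β x) = n • (φ ⊼ β) :=
  wedge_mapC (AddMonoidHom.mk' (fun x : N => n • x) (smul_add n)) φ β

theorem wedge_neg (φ : Multi L P) (β : P → Multi L N) : (φ ⊼ fun x => -β x) = -(φ ⊼ β) :=
  wedge_mapC (-AddMonoidHom.id N) φ β

theorem wedge_sub (φ : Multi L P) (β β' : P → Multi L N) :
    (φ ⊼ fun x => β x - β' x) = φ ⊼ β - φ ⊼ β' := by
  simp only [sub_eq_add_neg, wedge_add, wedge_neg]

theorem wedge_zero (φ : Multi L P) : (φ ⊼ fun _ => (0 : Multi L N)) = 0 :=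
  wedge_mapC (0 : N →+ N) φ fun _ => 0

theorem gradeInv_wedge (φ : Multi L P) {β : P → Multi L N} (hβ : ∀ x y, β (x + y) = β x + β y) :
    gradeInv (φ ⊼ β) = gradeInv φ ⊼ fun x => gradeInv (β x) := by
  funext m Z
  induction m generalizing φ β with
  | zero => simp [wedge_apply_zero, gradeInv]
  | succ m ih =>
    have hg : ∀ x y, gradeInv (β (x + y)) = gradeInv (β x) + gradeInv (β y) := fun x y => by
      rw [hβ, gradeInv_add]
    have hc : ∀ x y, contr (Z 0) (β (x + y)) = contr (Z 0) (β x) + contr (Z 0) (β y) :=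
      fun x y => by rw [hβ, contr_add]
    rw [succ_eq_contr (gradeInv _), succ_eq_contr (_ ⊼ _), contr_gradeInv, contr_wedge, contr_wedge,
      gradeInv_add]
    simp only [contr_gradeInv, neg_wedge _ (β := fun x => gradeInv (β x)) hg, wedge_neg,
      Pi.add_apply, Pi.neg_apply]
    rw [ih _ hβ, ih _ hc]
    abel

theorem deg0_wedge (x : P) {β : P → Multi L N} (h0 : β 0 = 0) : deg0 x ⊼ β = β x := by
  funext m Z
  induction m generalizing β with
  | zero => simp [wedge_apply_zero, deg0]
  | succ m ih =>
    rw [wedge_apply_succ, contr_deg0, gradeInv_deg0, zero_wedge h0, ih (by simp [h0]),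
      succ_eq_contr (β x)]
    simp

theorem wedge_deg0 (ψ : Multi L P) (S : P → N) : (ψ ⊼ fun x => deg0 (S x)) = mapC S ψ := by
  funext m Z
  induction m generalizing ψ with
  | zero => simp [wedge_apply_zero, deg0, mapC]
  | succ m ih =>
    rw [wedge_apply_succ, ih]
    simp only [contr_deg0, wedge_zero]
    simp [mapC, contr, Fin.cons_self_tail]

theorem wedge_assoc (φ : Multi L P) (β : P → Multi L Q) {γ : Q → Multi L N}
    (hγ : ∀ x y, γ (x + y) = γ x + γ y) (hβ : ∀ x y, β (x + y) = β x + β y) :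
    (φ ⊼ fun x => β x ⊼ γ) = (φ ⊼ β) ⊼ γ := by
  funext m Z
  induction m generalizing φ β γ with
  | zero => simp [wedge_apply_zero]
  | succ m ih =>
    have hcβ : ∀ x y, contr (Z 0) (β (x + y)) = contr (Z 0) (β x) + contr (Z 0) (β y) :=
      fun x y => by rw [hβ, contr_add]
    have hgβ : ∀ x y, gradeInv (β (x + y)) = gradeInv (β x) + gradeInv (β y) :=
      fun x y => by rw [hβ, gradeInv_add]
    have hcγ : ∀ x y, contr (Z 0) (γ (x + y)) = contr (Z 0) (γ x) + contr (Z 0) (γ y) :=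
      fun x y => by rw [hγ, contr_add]
    simp only [wedge_apply_succ, contr_wedge, wedge_add, add_wedge _ _ hγ, gradeInv_wedge φ hβ,
      Pi.add_apply]
    rw [ih _ _ hγ hβ, ih _ _ hγ hcβ, ih _ _ hcγ hgβ]
    abel

/-- `φ` is a sum of components whose degrees have the parity of `k`. This is all that the signs
depend on, and a contraction changes the parity by one also in degree `0`, where the degree itself
cannot be lowered. -/
def HasParity (k : ℕ) (φ : Multi L N) : Prop := ∀ m, Odd (m + k) → φ m = 0

namespace HasParity

theorem single (k : ℕ) (φ : (Fin k → L) → N) : HasParity k (Pi.single k φ : Multi L N) := by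
  intro m hm
  refine Pi.single_eq_of_ne ?_ _
  rintro rfl
  exact Nat.not_odd_iff_even.2 (Even.add_self m) hm

theorem congr {k l : ℕ} {φ : Multi L N} (h : HasParity k φ) (hkl : Even (k + l)) :
    HasParity l φ := fun m hm => h m (by grind)

theorem contr {k : ℕ} {φ : Multi L N} (h : HasParity k φ) (X : L) :
    HasParity (k + 1) (contr X φ) := fun m hm => by
  funext Z
  rw [LieAlgd.contr, h (m + 1) (by grind)]
  rfl

theorem gradeInv {k : ℕ} {φ : Multi L N} (h : HasParity k φ) :
    HasParity k (gradeInv φ) := fun m hm => by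
  funext Z
  simp [LieAlgd.gradeInv, h m hm]

theorem gradeInv_eq {k : ℕ} {φ : Multi L N} (h : HasParity k φ) :
    LieAlgd.gradeInv φ = (-1 : ℤ) ^ k • φ := by
  funext m Z
  rcases Nat.even_or_odd (m + k) with hm | hm
  · have : (-1 : ℤ) ^ m = (-1) ^ k := by
      rcases Nat.even_or_odd k with hk | hk
      · rw [hk.neg_one_pow, ((Nat.even_add.1 hm).2 hk).neg_one_pow]
      · have hm' : Odd m := by grind
        rw [hk.neg_one_pow, hm'.neg_one_pow]
    simp [LieAlgd.gradeInv, this]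
  · simp [LieAlgd.gradeInv, h m hm]

theorem sub {k : ℕ} {φ ψ : Multi L N} (h : HasParity k φ) (h' : HasParity k ψ) :
    HasParity k (φ - ψ) := fun m hm => by
  simp [h m hm, h' m hm]

theorem mapC {k : ℕ} {φ : Multi L N} (h : HasParity k φ) (T : N →+ N') :
    HasParity k (mapC T φ) := fun m hm => by
  funext Z
  simp [LieAlgd.mapC, h m hm]

theorem wedge {a b : ℕ} {φ : Multi L P} {β : P → Multi L N} (hφ : HasParity a φ)
    (hβ : ∀ x, HasParity b (β x)) (h0 : β 0 = 0) : HasParity (a + b) (φ ⊼ β) := by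
  intro m hm
  funext Z
  induction m generalizing a b φ β with
  | zero =>
    rcases Nat.even_or_odd a with ha | ha
    · rw [wedge_apply_zero, hβ _ 0 (by grind)]
    · rw [wedge_apply_zero, hφ 0 (by grind)]
      simp [h0]
  | succ m ih =>
    rw [wedge_apply_succ, ih (hφ.contr _) hβ h0 (by grind),
      ih hφ.gradeInv (fun x => (hβ x).contr _) (by simp [h0]) (by grind)]
    simp

end HasParity

/-- Graded commutativity of the wedge product, for `φ` of parity `k` and `ψ` of parity `l`. -/
theorem wedge_swap {k l : ℕ} {φ : Multi L P} {ψ : Multi L Q} (hφ : HasParity k φ)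
    (hψ : HasParity l ψ) {β : P → Q → Multi L N} (h₁ : ∀ x y z, β (x + y) z = β x z + β y z)
    (h₂ : ∀ x y z, β x (y + z) = β x y + β x z) :
    (ψ ⊼ fun y => φ ⊼ fun x => β x y) = (-1 : ℤ) ^ (k * l) • (φ ⊼ fun x => ψ ⊼ β x) := by
  funext m Z
  have h0 : ∀ y, β 0 y = 0 := fun y => by simpa using h₁ 0 0 y
  have h0' : ∀ x, β x 0 = 0 := fun x => by simpa using h₂ x 0 0
  induction m generalizing k l φ ψ β with
  | zero =>
    simp only [wedge_apply_zero, Pi.smul_apply]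
    rcases Nat.even_or_odd k with hk | hk
    · rw [(hk.mul_right l).neg_one_pow, one_smul]
    · simp [hφ 0 (by simpa using hk), h0]
  | succ m ih =>
    have c₁ : ∀ x y z, contr (Z 0) (β (x + y) z) = contr (Z 0) (β x z) + contr (Z 0) (β y z) :=
      fun x y z => by rw [h₁, contr_add]
    have c₂ : ∀ x y z, contr (Z 0) (β x (y + z)) = contr (Z 0) (β x y) + contr (Z 0) (β x z) :=
      fun x y z => by rw [h₂, contr_add]
    have s₁ : ∀ (n : ℤ) y, ((n • φ) ⊼ fun x => contr (Z 0) (β x y))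
        = n • (φ ⊼ fun x => contr (Z 0) (β x y)) := fun n y => zsmul_wedge n φ fun _ _ => c₁ _ _ _
    have s₂ : ∀ (n : ℤ) x, ((n • ψ) ⊼ fun y => contr (Z 0) (β x y))
        = n • (ψ ⊼ fun y => contr (Z 0) (β x y)) := fun n x => zsmul_wedge n ψ (c₂ x)
    have a₁ : ∀ y z, (φ ⊼ fun x => contr (Z 0) (β x (y + z)))
        = (φ ⊼ fun x => contr (Z 0) (β x y)) + φ ⊼ fun x => contr (Z 0) (β x z) :=
      fun y z => by simp only [c₂, wedge_add]
    have a₂ : ∀ x y, (ψ ⊼ fun z => contr (Z 0) (β (x + y) z))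
        = (ψ ⊼ fun z => contr (Z 0) (β x z)) + ψ ⊼ fun z => contr (Z 0) (β y z) :=
      fun x y => by simp only [c₁, wedge_add]
    have a₃ : ∀ y z, (contr (Z 0) φ ⊼ fun x => β x (y + z))
        = (contr (Z 0) φ ⊼ fun x => β x y) + contr (Z 0) φ ⊼ fun x => β x z :=
      fun y z => by simp only [h₂, wedge_add]
    have a₄ : ∀ x y, (contr (Z 0) ψ ⊼ β (x + y)) = contr (Z 0) ψ ⊼ β x + contr (Z 0) ψ ⊼ β y :=
      fun x y => by rw [← wedge_add]; simp only [← h₁]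
    have e₁ := ih hφ (hψ.contr (Z 0)) h₁ h₂ (Fin.tail Z) h0 h0'
    have e₂ := ih (hφ.contr (Z 0)) hψ h₁ h₂ (Fin.tail Z) h0 h0'
    have e₃ := ih hφ hψ (β := fun x y => contr (Z 0) (β x y)) c₁ c₂ (Fin.tail Z) (by simp [h0])
      (by simp [h0'])
    simp only [Pi.smul_apply] at e₁ e₂ e₃ ⊢
    simp only [wedge_apply_succ, contr_wedge, wedge_add, hφ.gradeInv_eq, hψ.gradeInv_eq,
      zsmul_wedge _ _ (β := fun y => φ ⊼ fun x => contr (Z 0) (β x y)) a₁,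
      zsmul_wedge _ _ (β := fun x => ψ ⊼ fun z => contr (Z 0) (β x z)) a₂,
      zsmul_wedge _ _ (β := fun y => contr (Z 0) φ ⊼ fun x => β x y) a₃,
      zsmul_wedge _ _ (β := fun x => contr (Z 0) ψ ⊼ β x) a₄,
      wedge_zsmul, Pi.add_apply, Pi.smul_apply, s₁, s₂]
    rw [e₁, e₂, e₃]
    rcases neg_one_pow_eq_or ℤ k with hk | hk <;> rcases neg_one_pow_eq_or ℤ l with hl | hl <;>
      simp [pow_add, add_mul, mul_add, pow_mul, hk, hl] <;> abel

end GradedCochains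
/-! ### Tensorial cochains -/

section Tensorial

theorem wedge_smul {R L N P : Type*} [CommRing R] [AddCommGroup N] [Module R N] [AddCommGroup P]
    (f : R) (φ : Multi L P) (β : P → Multi L N) : (φ ⊼ fun x => f • β x) = f • (φ ⊼ β) :=
  wedge_mapC (DistribSMul.toAddMonoidHom N f) φ β

theorem deg1_smul {R L N : Type*} [CommRing R] [AddCommGroup N] [Module R N] (f : R) (S : L → N) :
    deg1 (f • S) = f • deg1 S := by
  rw [deg1, deg1, ← Pi.single_smul]; rfl

theorem gradeInv_smul {R L N : Type*} [CommRing R] [AddCommGroup N] [Module R N] (f : R)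
    (α : Multi L N) : gradeInv (f • α) = f • gradeInv α := by
  funext k Z; simp [gradeInv, smul_comm f]

theorem smul_wedge {R L N P : Type*} [CommRing R] [AddCommGroup N] [Module R N]
    [AddCommGroup P] [Module R P] (f : R) (φ : Multi L P) {β : P → Multi L N}
    (hβ : ∀ (f : R) x, β (f • x) = f • β x) : (f • φ) ⊼ β = f • (φ ⊼ β) := by
  funext m Z
  induction m generalizing φ β with
  | zero => simp [wedge_apply_zero, hβ]
  | succ m ih =>
    simp only [Pi.smul_apply, wedge_apply_succ, gradeInv_smul, smul_add]
    exact congrArg₂ (· + ·) (ih _ hβ _)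
      (ih _ (β := fun x => contr (Z 0) (β x)) (fun f x => by rw [hβ]; rfl) _)

variable {R L N P : Type*} [CommRing R] [AddCommGroup L] [Module R L] [AddCommGroup N] [Module R N]
  [AddCommGroup P] [Module R P]

variable (R) in
/-- `α` is linear and alternating in its first `n` arguments, as far as this can be seen by
contracting at most `n` times. -/
def TensorialUpTo : ℕ → Multi L N → Prop
  | 0, _ => True
  | n + 1, α => (∀ X Y, contr (X + Y) α = contr X α + contr Y α) ∧
      (∀ (f : R) X, contr (f • X) α = f • contr X α) ∧ (∀ X, contr X (contr X α) = 0) ∧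
      ∀ X, TensorialUpTo n (contr X α)

namespace TensorialUpTo

theorem of_succ {n : ℕ} {α : Multi L N} (h : TensorialUpTo R (n + 1) α) :
    TensorialUpTo R n α := by
  induction n generalizing α with
  | zero => trivial
  | succ n ih => exact ⟨h.1, h.2.1, h.2.2.1, fun X => ih (h.2.2.2 X)⟩

theorem add {n : ℕ} {α β : Multi L N} (hα : TensorialUpTo R n α) (hβ : TensorialUpTo R n β) :
    TensorialUpTo R n (α + β) := by
  induction n generalizing α β with
  | zero => trivial
  | succ n ih =>
    refine ⟨fun X Y => ?_, fun f X => ?_, fun X => ?_, fun X => ih (hα.2.2.2 X) (hβ.2.2.2 X)⟩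
    · simp only [contr_add, hα.1, hβ.1]; abel
    · simp only [contr_add, hα.2.1, hβ.2.1, smul_add]
    · simp only [contr_add, hα.2.2.1, hβ.2.2.1, add_zero]

theorem zsmul {n : ℕ} {α : Multi L N} (c : ℤ) (hα : TensorialUpTo R n α) :
    TensorialUpTo R n (c • α) := by
  induction n generalizing α with
  | zero => trivial
  | succ n ih =>
    refine ⟨fun X Y => ?_, fun f X => ?_, fun X => ?_, fun X => ih (hα.2.2.2 X)⟩
    · simp only [contr_zsmul, hα.1, smul_add]
    · simp only [contr_zsmul, hα.2.1, smul_comm f c]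
    · simp only [contr_zsmul, hα.2.2.1, smul_zero]

theorem neg {n : ℕ} {α : Multi L N} (hα : TensorialUpTo R n α) : TensorialUpTo R n (-α) := by
  simpa using hα.zsmul (-1)

theorem sub {n : ℕ} {α β : Multi L N} (hα : TensorialUpTo R n α) (hβ : TensorialUpTo R n β) :
    TensorialUpTo R n (α - β) := by
  simpa [sub_eq_add_neg] using hα.add hβ.neg

theorem gradeInv {n : ℕ} {α : Multi L N} (hα : TensorialUpTo R n α) :
    TensorialUpTo R n (gradeInv α) := by
  induction n generalizing α with
  | zero => trivial
  | succ n ih =>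
    refine ⟨fun X Y => ?_, fun f X => ?_, fun X => ?_, fun X => ?_⟩
    · simp only [contr_gradeInv, hα.1, gradeInv_add, neg_add]
    · simp only [contr_gradeInv, hα.2.1, gradeInv_smul, smul_neg]
    · simp only [contr_gradeInv, contr_neg, hα.2.2.1, gradeInv_zero, neg_zero]
    · rw [contr_gradeInv]
      exact (ih (hα.2.2.2 X)).neg

end TensorialUpTo

theorem TensorialUpTo.wedge {n : ℕ} {φ : Multi L P} {β : P → Multi L N}
    (hφ : TensorialUpTo R n φ) (hβ : ∀ x, TensorialUpTo R n (β x))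
    (hadd : ∀ x y, β (x + y) = β x + β y) (hsmul : ∀ (f : R) x, β (f • x) = f • β x) :
    TensorialUpTo R n (φ ⊼ β) := by
  induction n generalizing φ β with
  | zero => trivial
  | succ n ih =>
    have hadd' : ∀ X x y, contr X (β (x + y)) = contr X (β x) + contr X (β y) :=
      fun X x y => by rw [hadd, contr_add]
    have hsmul' : ∀ X (f : R) x, contr X (β (f • x)) = f • contr X (β x) :=
      fun X f x => by rw [hsmul]; rfl
    refine ⟨fun X Y => ?_, fun f X => ?_, fun X => ?_, fun X => ?_⟩
    · simp only [contr_wedge, hφ.1, add_wedge _ _ hadd, (hβ _).1, wedge_add]; abel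
    · simp only [contr_wedge, hφ.2.1, smul_wedge _ _ hsmul, (hβ _).2.1, wedge_smul, smul_add]
    · simp only [contr_wedge, contr_add, hφ.2.2.1, (hβ _).2.2.1, contr_gradeInv, wedge_zero,
        gradeInv_gradeInv]
      have h0 : β 0 = 0 := by simpa using hadd 0 0
      rw [zero_wedge h0, neg_wedge _ (hadd' X)]
      abel
    · rw [contr_wedge]
      exact (ih (hφ.2.2.2 X) (fun x => (hβ x).of_succ) hadd hsmul).add
        (ih hφ.gradeInv.of_succ (fun x => (hβ x).2.2.2 X) (hadd' X) (hsmul' X))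

variable (R) in
/-- `α` is `R`-multilinear and alternating in every degree. -/
def IsTensorial (α : Multi L N) : Prop := ∀ n, TensorialUpTo R n α

namespace IsTensorial

variable {α β : Multi L N}

theorem contr_add_left (h : IsTensorial R α) (X Y : L) :
    contr (X + Y) α = contr X α + contr Y α := (h 1).1 X Y

theorem contr_smul_left (h : IsTensorial R α) (f : R) (X : L) :
    contr (f • X) α = f • contr X α := (h 1).2.1 f X

theorem contr_zero_left (h : IsTensorial R α) : contr 0 α = 0 := by
  simpa using h.contr_add_left 0 0

theorem contr_contr_self (h : IsTensorial R α) (X : L) : contr X (contr X α) = 0 :=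
  (h 1).2.2.1 X

theorem contr_swap (h : IsTensorial R α) (X Y : L) :
    contr X (contr Y α) = -contr Y (contr X α) := by
  have := h.contr_contr_self (X + Y)
  simp only [h.contr_add_left, contr_add] at this
  have h' : ∀ W W' : L, contr (X + Y) (contr W α) = contr X (contr W α) + contr Y (contr W α) :=
    fun W _ => (h 2).2.2.2 W |>.1 X Y
  rw [h' _ X, h' _ X, h.contr_contr_self, h.contr_contr_self] at this
  rw [eq_neg_iff_add_eq_zero, ← this]
  abel

protected theorem contr (h : IsTensorial R α) (X : L) : IsTensorial R (contr X α) :=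
  fun n => (h (n + 1)).2.2.2 X

theorem add (hα : IsTensorial R α) (hβ : IsTensorial R β) : IsTensorial R (α + β) :=
  fun n => (hα n).add (hβ n)

theorem sub (hα : IsTensorial R α) (hβ : IsTensorial R β) : IsTensorial R (α - β) :=
  fun n => (hα n).sub (hβ n)

theorem zsmul (c : ℤ) (hα : IsTensorial R α) : IsTensorial R (c • α) :=
  fun n => (hα n).zsmul c

theorem wedge {φ : Multi L P} {β : P → Multi L N}
    (hφ : IsTensorial R φ) (hβ : ∀ x, IsTensorial R (β x))
    (hadd : ∀ x y, β (x + y) = β x + β y) (hsmul : ∀ (f : R) x, β (f • x) = f • β x) :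
    IsTensorial R (φ ⊼ β) :=
  fun n => (hφ n).wedge (fun x => hβ x n) hadd hsmul

/-- A tensorial cochain is a family of alternating maps over `R`. -/
theorem exists_alternatingMap (h : IsTensorial R α) (m : ℕ) :
    ∃ T : L [⋀^Fin m]→ₗ[R] N, α m = T := by
  have hadd : ∀ (m : ℕ) (α : Multi L N), IsTensorial R α → ∀ (Z : Fin m → L) (i : Fin m) (x y : L),
      α m (Function.update Z i (x + y)) =
        α m (Function.update Z i x) + α m (Function.update Z i y) := by
    intro m
    induction m with
    | zero => exact fun _ _ _ i => i.elim0
    | succ m ih =>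
      intro α h Z i x y
      obtain ⟨W, Z, rfl⟩ : ∃ W Z', Z = Fin.cons W Z' := ⟨_, _, (Fin.cons_self_tail Z).symm⟩
      cases i using Fin.cases with
      | zero => simpa [contr] using congrFun (congrFun (h.contr_add_left x y) m) Z
      | succ i => simpa [← Fin.cons_update, contr] using ih _ (h.contr W) Z i x y
  have hsmul : ∀ (m : ℕ) (α : Multi L N), IsTensorial R α → ∀ (Z : Fin m → L) (i : Fin m) (f : R)
      (x : L), α m (Function.update Z i (f • x)) = f • α m (Function.update Z i x) := by
    intro m
    induction m with
    | zero => exact fun _ _ _ i => i.elim0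
    | succ m ih =>
      intro α h Z i f x
      obtain ⟨W, Z, rfl⟩ : ∃ W Z', Z = Fin.cons W Z' := ⟨_, _, (Fin.cons_self_tail Z).symm⟩
      cases i using Fin.cases with
      | zero => simpa [contr] using congrFun (congrFun (h.contr_smul_left f x) m) Z
      | succ i => simpa [← Fin.cons_update, contr] using ih _ (h.contr W) Z i f x
  have halt : ∀ (m : ℕ) (α : Multi L N), IsTensorial R α → ∀ (Z : Fin m → L) (i j : Fin m),
      Z i = Z j → i < j → α m Z = 0 := by
    intro m
    induction m with
    | zero => exact fun _ _ _ i => i.elim0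
    | succ m ih =>
      intro α h Z i j hZ hij
      rw [succ_eq_contr α]
      cases j using Fin.cases with
      | zero => exact absurd hij (Fin.not_lt_zero i)
      | succ j =>
      cases i using Fin.cases with
      | succ i => exact ih _ (h.contr _) _ i j hZ (Fin.succ_lt_succ_iff.1 hij)
      | zero =>
      -- Either the repeated entries are the first two, or the first two are exchanged.
      cases m with
      | zero => exact j.elim0
      | succ m =>
      rw [succ_eq_contr (contr _ α)]
      cases j using Fin.cases with
      | zero =>
        have : Fin.tail Z 0 = Z 0 := hZ.symm
        rw [this, h.contr_contr_self]
        rfl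
      | succ j =>
        rw [h.contr_swap]
        have := ih _ (h.contr (Fin.tail Z 0)) (Fin.cons (Z 0) (Fin.tail (Fin.tail Z))) 0 j.succ
          (by simpa [Fin.tail] using hZ) (Fin.succ_pos j)
        simp only [Pi.neg_apply, neg_eq_zero]
        exact this
  refine ⟨{ toFun := α m, map_update_add' := ?_, map_update_smul' := ?_,
            map_eq_zero_of_eq' := ?_ }, rfl⟩
  · intro hd Z i x y
    convert hadd m α h Z i x y
  · intro hd Z i f x
    convert hsmul m α h Z i f x
  · intro Z i j hZ hij
    rcases lt_or_gt_of_ne hij with hlt | hlt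
    · exact halt m α h Z i j hZ hlt
    · exact halt m α h Z j i hZ.symm hlt

end IsTensorial

theorem isTensorial_zero : IsTensorial R (0 : Multi L N) := by
  intro n
  induction n with
  | zero => trivial
  | succ n ih => exact ⟨by simp, by simp, by simp, by simpa using ih⟩

theorem isTensorial_deg0 (x : N) : IsTensorial R (deg0 x : Multi L N) := by
  intro n
  cases n with
  | zero => trivial
  | succ n => exact ⟨by simp, by simp, by simp, by simpa using isTensorial_zero n⟩

theorem isTensorial_deg1_id : IsTensorial R (deg1 id : Multi L L) := by
  intro n
  cases n with
  | zero => trivial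
  | succ n =>
    refine ⟨fun X Y => ?_, fun f X => ?_, by simp, fun X => ?_⟩
    · simp only [contr_deg1, deg0, id, ← Pi.single_add]; rfl
    · simp only [contr_deg1, deg0, id, ← Pi.single_smul]; rfl
    · simpa using isTensorial_deg0 X n

/-- A homogeneous cochain given by an alternating map is tensorial. -/
theorem isTensorial_single {k : ℕ} (T : L [⋀^Fin k]→ₗ[R] N) :
    IsTensorial R (Pi.single k T : Multi L N) := by
  intro n
  induction n generalizing k with
  | zero => trivial
  | succ n ih =>
    cases k with
    | zero =>
      refine ⟨?_, ?_, ?_, ?_⟩ <;> simp only [contr_single_zero]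
      · simp
      · simp
      · simp
      · exact fun _ => isTensorial_zero n
    | succ k =>
      have key : ∀ X, contr X (Pi.single (k + 1) T : Multi L N) = Pi.single k (T.curryLeft X) :=
        fun X => by rw [contr_single_succ]; rfl
      refine ⟨fun X Y => ?_, fun f X => ?_, fun X => ?_, fun X => ?_⟩
      · rw [key, key, key, ← Pi.single_add, map_add]; rfl
      · rw [key, key, ← Pi.single_smul, map_smul]; rfl
      · rw [key]
        cases k with
        | zero => exact contr_single_zero _ _
        | succ k =>
          rw [contr_single_succ]
          have : (fun Z => T.curryLeft X (Fin.cons X Z)) = 0 := by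
            funext Z
            exact T.map_eq_zero_of_eq (i := 0) (j := 1) _ rfl (by simp)
          rw [this, Pi.single_zero]
      · rw [key]; exact ih _

end Tensorial
/-! ### Insertion operators -/

section Insertion

variable {R L N P : Type*} [CommRing R] [AddCommGroup L] [Module R L] [AddCommGroup N] [Module R N]
  [AddCommGroup P] [Module R P]

/-- The insertion operator `i_φ α`, the wedge product of `φ` with `X ↦ ι_X α`. -/
def insC (φ : Multi L L) (α : Multi L N) : Multi L N := φ ⊼ fun X => contr X α

theorem insC_add_right (φ : Multi L L) (α β : Multi L N) :
    insC φ (α + β) = insC φ α + insC φ β := wedge_add _ _ _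

theorem insC_sub_right (φ : Multi L L) (α β : Multi L N) :
    insC φ (α - β) = insC φ α - insC φ β := wedge_sub _ _ _

theorem insC_zsmul_right (n : ℤ) (φ : Multi L L) (α : Multi L N) :
    insC φ (n • α) = n • insC φ α := wedge_zsmul _ _ _

theorem insC_zero_right (φ : Multi L L) : insC φ (0 : Multi L N) = 0 := wedge_zero _

theorem HasParity.insC {k l : ℕ} {φ : Multi L L} {α : Multi L N} (hφ : HasParity k φ)
    (hα : HasParity l α) (h0 : LieAlgd.contr 0 α = 0) : HasParity (k + l + 1) (insC φ α) :=
  hφ.wedge (fun X => hα.contr X) h0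

namespace IsTensorial

variable {α : Multi L N}

protected theorem insC (h : IsTensorial R α) {φ : Multi L L} (hφ : IsTensorial R φ) :
    IsTensorial R (insC φ α) :=
  hφ.wedge h.contr h.contr_add_left h.contr_smul_left

theorem insC_add_left (h : IsTensorial R α) (φ ψ : Multi L L) :
    LieAlgd.insC (φ + ψ) α = LieAlgd.insC φ α + LieAlgd.insC ψ α :=
  add_wedge _ _ h.contr_add_left

theorem insC_sub_left (h : IsTensorial R α) (φ ψ : Multi L L) :
    LieAlgd.insC (φ - ψ) α = LieAlgd.insC φ α - LieAlgd.insC ψ α :=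
  sub_wedge _ _ h.contr_add_left

theorem insC_zsmul_left (h : IsTensorial R α) (n : ℤ) (φ : Multi L L) :
    LieAlgd.insC (n • φ) α = n • LieAlgd.insC φ α :=
  zsmul_wedge _ _ h.contr_add_left

theorem insC_neg_left (h : IsTensorial R α) (φ : Multi L L) :
    LieAlgd.insC (-φ) α = -LieAlgd.insC φ α :=
  neg_wedge _ h.contr_add_left

theorem insC_deg0 (h : IsTensorial R α) (X : L) : LieAlgd.insC (deg0 X) α = LieAlgd.contr X α :=
  deg0_wedge X h.contr_zero_left

/-- `[ι_X, i_ψ] = i_{ι_X ψ}`. -/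
theorem contr_insC (h : IsTensorial R α) (X : L) (ψ : Multi L L) :
    LieAlgd.contr X (LieAlgd.insC ψ α) =
      LieAlgd.insC (LieAlgd.contr X ψ) α - LieAlgd.insC (gradeInv ψ) (LieAlgd.contr X α) := by
  rw [LieAlgd.insC, contr_wedge]
  simp only [fun Y => h.contr_swap X Y, wedge_neg]
  rw [LieAlgd.insC, LieAlgd.insC, sub_eq_add_neg]

end IsTensorial

/-- `i_ψ` is a graded derivation of the wedge product, of degree `l - 1`; the exponent `l + 1` has
the same parity and needs no subtraction. -/
theorem insC_wedge {k l : ℕ} {φ : Multi L P} {ψ : Multi L L} (hφ : HasParity k φ)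
    (hφt : IsTensorial R φ) (hψ : HasParity l ψ) {β : P → Multi L N}
    (hβ : ∀ x, IsTensorial R (β x)) (hadd : ∀ x y, β (x + y) = β x + β y) :
    insC ψ (φ ⊼ β) = insC ψ φ ⊼ β + (-1 : ℤ) ^ (k * (l + 1)) • (φ ⊼ fun x => insC ψ (β x)) := by
  have h1 : ∀ Y x y, contr Y (β (x + y)) = contr Y (β x) + contr Y (β y) := fun Y x y => by
    rw [hadd, contr_add]
  have e : ∀ Y, contr Y (φ ⊼ β) =
      contr Y φ ⊼ β + (-1 : ℤ) ^ k • (φ ⊼ fun x => contr Y (β x)) := fun Y => by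
    rw [contr_wedge, hφ.gradeInv_eq, zsmul_wedge _ _ (h1 Y)]
  unfold insC
  simp only [e]
  rw [wedge_add, wedge_zsmul, wedge_assoc _ _ hadd hφt.contr_add_left,
    wedge_swap hφ hψ (β := fun x Y => contr Y (β x)) (fun x y Y => h1 Y x y)
      (fun x => (hβ x).contr_add_left), smul_smul, ← pow_add]
  congr 3
  ring

/-- The Nijenhuis–Richardson commutation relation for `i_φ` and `i_ψ`, where `φ` and `ψ` have
parities `k` and `l`. -/
theorem IsTensorial.insC_insC {k l : ℕ} {φ ψ : Multi L L} (hφ : HasParity k φ)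
    (hφt : ∀ X Y, contr (X + Y) φ = contr X φ + contr Y φ) (hψ : HasParity l ψ)
    (hψt : ∀ X Y, contr (X + Y) ψ = contr X ψ + contr Y ψ) {α : Multi L N}
    (h : IsTensorial R α) :
    LieAlgd.insC φ (LieAlgd.insC ψ α)
        - (-1 : ℤ) ^ ((k + 1) * (l + 1)) • LieAlgd.insC ψ (LieAlgd.insC φ α) =
      LieAlgd.insC (LieAlgd.insC φ ψ) α
        - (-1 : ℤ) ^ ((k + 1) * (l + 1)) • LieAlgd.insC (LieAlgd.insC ψ φ) α := by
  -- Both products reduce to the double insertion `φ ⊼ (X ↦ ψ ⊼ (Y ↦ ι_Y ι_X α))`.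
  have key : ∀ {l : ℕ} {φ ψ : Multi L L}, HasParity l ψ →
      (∀ X Y, contr (X + Y) ψ = contr X ψ + contr Y ψ) →
      LieAlgd.insC φ (LieAlgd.insC ψ α) = LieAlgd.insC (LieAlgd.insC φ ψ) α
        - (-1 : ℤ) ^ l • (φ ⊼ fun X => ψ ⊼ fun Y => contr Y (contr X α)) := by
    intro l φ ψ hψ hψt
    have e : ∀ X, contr X (LieAlgd.insC ψ α) = LieAlgd.insC (contr X ψ) α -
        (-1 : ℤ) ^ l • LieAlgd.insC ψ (contr X α) := fun X => by
      rw [h.contr_insC, hψ.gradeInv_eq, (h.contr X).insC_zsmul_left]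
    rw [LieAlgd.insC]
    simp only [e]
    rw [wedge_sub, wedge_zsmul]
    congr 1
    exact wedge_assoc _ _ h.contr_add_left hψt
  rw [key hψ hψt, key hφ hφt]
  have hs : (ψ ⊼ fun X => φ ⊼ fun Y => contr Y (contr X α)) =
      -((-1 : ℤ) ^ (k * l) • (φ ⊼ fun X => ψ ⊼ fun Y => contr Y (contr X α))) := by
    rw [wedge_swap hφ hψ (β := fun X Y => contr X (contr Y α))
      (fun X Y W => (h.contr W).contr_add_left X Y)
      (fun X Y W => by rw [h.contr_add_left, contr_add])]
    have e : (fun X => ψ ⊼ fun Y => contr X (contr Y α)) =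
        fun X => -(ψ ⊼ fun Y => contr Y (contr X α)) := funext fun X => by
      rw [← wedge_neg]
      congr 1
      exact funext fun Y => h.contr_swap X Y
    rw [e, wedge_neg, smul_neg]
  rw [hs]
  rcases neg_one_pow_eq_or ℤ k with hk | hk <;> rcases neg_one_pow_eq_or ℤ l with hl | hl <;>
    simp [pow_add, add_mul, mul_add, pow_mul, hk, hl]
  abel

end Insertion

/-! ### Covariant derivatives of cochains -/

section Connections

/-- An algebraic connection: `L` acts on `R` by `ρ` and on the `R`-module `N` by additive
operators satisfying the Leibniz rule. -/
structure ModuleConnection (R L N : Type*) [CommRing R] [AddCommGroup L] [Module R L]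
    [AddCommGroup N] [Module R N] (ρ : L → R → R) where
  /-- the operators `∇_X` -/
  nabla : L → N →+ N
  add_left : ∀ X Y, nabla (X + Y) = nabla X + nabla Y
  smul_left : ∀ (f : R) X s, nabla (f • X) s = f • nabla X s
  leibniz : ∀ X (f : R) s, nabla X (f • s) = ρ X f • s + f • nabla X s

variable {R L N P : Type*} [CommRing R] [AddCommGroup L] [Module R L] [AddCommGroup N] [Module R N]
  {ρ : L → R → R} (D : ModuleConnection R L L ρ) (C : ModuleConnection R L N ρ)

/-- The covariant derivative `∇_X α` of a cochain, for a connection `C` on the values and a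
connection `D` on the arguments: `∇_X ∘ α - i_{D_X} α`. -/
def covDer (X : L) (α : Multi L N) : Multi L N :=
  mapC (C.nabla X) α - insC (deg1 (D.nabla X)) α

/-- The operator `∇_φ`, the wedge product of `φ` with `X ↦ ∇_X α`. -/
def covDerAlong (φ : Multi L L) (α : Multi L N) : Multi L N := φ ⊼ fun X => covDer D C X α

/-- The exterior covariant derivative, in the form `∇_φ` for `φ` the identity of `L`. -/
def dC (α : Multi L N) : Multi L N := covDerAlong D C (deg1 id) α

/-- The covariant Lie derivative `i_φ d + (-1)^k d i_φ`, for `φ` of parity `k`. -/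
def lieC (k : ℕ) (φ : Multi L L) (α : Multi L N) : Multi L N :=
  insC φ (dC D C α) + (-1 : ℤ) ^ k • dC D C (insC φ α)

theorem covDer_zero_right (X : L) : covDer D C X 0 = 0 := by
  rw [covDer, insC_zero_right, sub_zero]
  funext k Z; simp [mapC]

theorem covDer_add_right (X : L) (α β : Multi L N) :
    covDer D C X (α + β) = covDer D C X α + covDer D C X β := by
  simp only [covDer, mapC_add, insC_add_right]; abel

theorem covDer_sub_right (X : L) (α β : Multi L N) :
    covDer D C X (α - β) = covDer D C X α - covDer D C X β := by
  simp only [covDer, mapC_sub, insC_sub_right]; abel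

theorem covDer_smul_right (X : L) (f : R) (α : Multi L N) :
    covDer D C X (f • α) = ρ X f • α + f • covDer D C X α := by
  have h₁ : mapC (C.nabla X) (f • α) = ρ X f • α + f • mapC (C.nabla X) α := by
    funext k Z; simp [mapC, C.leibniz]
  have h₂ : insC (deg1 (D.nabla X)) (f • α) = f • insC (deg1 (D.nabla X)) α := wedge_smul f _ _
  rw [covDer, covDer, h₁, h₂, smul_sub]
  abel

variable {α : Multi L N}

theorem covDer_add_left (hα : IsTensorial R α) (X Y : L) :
    covDer D C (X + Y) α = covDer D C X α + covDer D C Y α := by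
  have h₁ : mapC (C.nabla (X + Y)) α = mapC (C.nabla X) α + mapC (C.nabla Y) α := by
    funext k Z; simp [mapC, C.add_left]
  have h₂ : deg1 (D.nabla (X + Y)) = deg1 (D.nabla X) + deg1 (D.nabla Y) := by
    rw [D.add_left]; exact deg1_add _ _
  rw [covDer, covDer, covDer, h₁, h₂, hα.insC_add_left]
  abel

theorem covDer_smul_left (hα : IsTensorial R α) (f : R) (X : L) :
    covDer D C (f • X) α = f • covDer D C X α := by
  have h₁ : mapC (C.nabla (f • X)) α = f • mapC (C.nabla X) α := by
    funext k Z; simp [mapC, C.smul_left]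
  have h₂ : deg1 (D.nabla (f • X)) = f • deg1 (D.nabla X) := by
    rw [← deg1_smul]; congr 1; funext Y; exact D.smul_left f X Y
  rw [covDer, covDer, h₁, h₂, insC, insC, smul_wedge _ _ hα.contr_smul_left, smul_sub]

/-- `∇_X` is compatible with contractions: `ι_Y (∇_X α) = ∇_X (ι_Y α) - ι_{D_X Y} α`. -/
theorem contr_covDer (hα : IsTensorial R α) (X Y : L) :
    contr Y (covDer D C X α) = covDer D C X (contr Y α) - contr (D.nabla X Y) α := by
  rw [covDer, covDer, contr_sub, contr_mapC, hα.contr_insC, contr_deg1, hα.insC_deg0,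
    gradeInv_deg1, (hα.contr Y).insC_neg_left]
  abel

theorem isTensorial_covDer (hα : IsTensorial R α) (X : L) : IsTensorial R (covDer D C X α) := by
  intro n
  induction n generalizing α with
  | zero => trivial
  | succ n ih =>
    refine ⟨fun Y W => ?_, fun f Y => ?_, fun Y => ?_, fun Y => ?_⟩
    · simp only [contr_covDer D C hα, hα.contr_add_left, covDer_add_right, map_add]; abel
    · simp only [contr_covDer D C hα, hα.contr_smul_left, covDer_smul_right, D.leibniz,
        hα.contr_add_left, smul_sub]
      abel
    · rw [contr_covDer D C hα, contr_sub, contr_covDer D C (hα.contr Y), hα.contr_contr_self,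
        covDer_zero_right, hα.contr_swap Y]
      abel
    · rw [contr_covDer D C hα]
      exact (ih (hα.contr Y)).sub (hα.contr _ n)

theorem isTensorial_covDerAlong {φ : Multi L L} (hφ : IsTensorial R φ) (hα : IsTensorial R α) :
    IsTensorial R (covDerAlong D C φ α) :=
  hφ.wedge (isTensorial_covDer D C hα) (covDer_add_left D C hα) (covDer_smul_left D C hα)

theorem isTensorial_dC (hα : IsTensorial R α) : IsTensorial R (dC D C α) :=
  isTensorial_covDerAlong D C isTensorial_deg1_id hα

theorem isTensorial_lieC (k : ℕ) {φ : Multi L L} (hφ : IsTensorial R φ) (hα : IsTensorial R α) :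
    IsTensorial R (lieC D C k φ α) :=
  ((isTensorial_dC D C hα).insC hφ).add ((isTensorial_dC D C (hα.insC hφ)).zsmul _)

theorem HasParity.covDer {k : ℕ} (h : HasParity k α) (hα : IsTensorial R α) (X : L) :
    HasParity k (covDer D C X α) :=
  (h.mapC (C.nabla X)).sub
    (((HasParity.single 1 fun Z => D.nabla X (Z 0)).insC h hα.contr_zero_left).congr (by grind))

theorem HasParity.dC {k : ℕ} (h : HasParity k α) (hα : IsTensorial R α) :
    HasParity (k + 1) (dC D C α) :=
  ((HasParity.single 1 fun Z => id (Z 0)).wedge (fun X => h.covDer D C hα X)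
    (by simpa using covDer_add_left D C hα 0 0)).congr (by grind)

/-- `[∇_X, i_ψ] = i_{∇_X ψ}`. -/
theorem covDer_insC {l : ℕ} {ψ : Multi L L} (hψ : HasParity l ψ) (hψt : IsTensorial R ψ)
    (hα : IsTensorial R α) (X : L) :
    covDer D C X (insC ψ α) = insC ψ (covDer D C X α) + insC (covDer D D X ψ) α := by
  have hS : HasParity 1 (deg1 (D.nabla X)) := HasParity.single 1 fun Z => D.nabla X (Z 0)
  have hSt : ∀ Y W, contr (Y + W) (deg1 (D.nabla X)) =
      contr Y (deg1 (D.nabla X)) + contr W (deg1 (D.nabla X)) := fun Y W => by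
    simp only [contr_deg1, map_add, deg0, ← Pi.single_add]; rfl
  have h₁ : mapC (C.nabla X) (insC ψ α) = insC ψ (mapC (C.nabla X) α) :=
    (wedge_mapC (C.nabla X) ψ fun Y => contr Y α).symm
  have h₂ : insC ψ (deg1 (D.nabla X)) = mapC (D.nabla X) ψ := by
    rw [insC]; simp only [contr_deg1]; exact wedge_deg0 ψ _
  have h₃ := hα.insC_insC hS hSt hψ hψt.contr_add_left
  have h₄ : (-1 : ℤ) ^ ((1 + 1) * (l + 1)) = 1 := by rw [pow_mul]; simp
  rw [h₄, one_smul, one_smul, h₂, sub_eq_iff_eq_add] at h₃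
  rw [covDer, covDer, covDer, h₁, h₃, insC_sub_right, hα.insC_sub_left]
  abel

/-- The commutator `[∇_φ, i_ψ] = i_{∇_φ ψ} - (-1)^{k(l-1)} ∇_{i_ψ φ}`. -/
theorem covDerAlong_insC {k l : ℕ} {φ ψ : Multi L L} (hφ : HasParity k φ)
    (hφt : IsTensorial R φ) (hψ : HasParity l ψ) (hψt : IsTensorial R ψ) (hα : IsTensorial R α) :
    covDerAlong D C φ (insC ψ α) - (-1 : ℤ) ^ (k * (l + 1)) • insC ψ (covDerAlong D C φ α) =
      insC (covDerAlong D D φ ψ) α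
        - (-1 : ℤ) ^ (k * (l + 1)) • covDerAlong D C (insC ψ φ) α := by
  have h₁ : covDerAlong D C φ (insC ψ α) =
      (φ ⊼ fun X => insC ψ (covDer D C X α)) + insC (covDerAlong D D φ ψ) α := by
    rw [covDerAlong]
    simp only [covDer_insC D C hψ hψt hα]
    rw [wedge_add]
    congr 1
    exact wedge_assoc _ _ hα.contr_add_left (covDer_add_left D D hψt)
  have h₂ : insC ψ (covDerAlong D C φ α) = covDerAlong D C (insC ψ φ) α +
      (-1 : ℤ) ^ (k * (l + 1)) • (φ ⊼ fun X => insC ψ (covDer D C X α)) :=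
    insC_wedge hφ hφt hψ (isTensorial_covDer D C hα) (covDer_add_left D C hα)
  rw [h₁, h₂]
  rcases neg_one_pow_eq_or ℤ (k * (l + 1)) with hs | hs <;> simp [hs] <;> abel

/-- The decomposition `L_φ = ∇_φ + (-1)^k i_{dφ}`. -/
theorem lieC_eq {k : ℕ} {φ : Multi L L} (hφ : HasParity k φ) (hφt : IsTensorial R φ)
    (hα : IsTensorial R α) :
    lieC D C k φ α = covDerAlong D C φ α + (-1 : ℤ) ^ k • insC (dC D D φ) α := by
  have hid : insC φ (deg1 id) = φ := by
    rw [insC]; simp only [contr_deg1]; exact wedge_deg0 φ _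
  have h := covDerAlong_insC D C (HasParity.single 1 fun Z => id (Z 0)) isTensorial_deg1_id
    hφ hφt hα
  rw [← deg1, hid] at h
  rw [lieC, dC, dC, dC]
  rw [sub_eq_iff_eq_add] at h
  rw [h]
  rcases neg_one_pow_eq_or ℤ k with hs | hs <;> simp [pow_add, hs] <;> abel

/-- The characterizing property of the Frölicher–Nijenhuis bracket, for the cochain
`L_φ ψ - (-1)^{kl} L_ψ φ`, where `φ` and `ψ` have parities `k` and `l`. -/
theorem lieC_insC {k l : ℕ} {φ ψ : Multi L L} (hφ : HasParity k φ)
    (hφt : IsTensorial R φ) (hψ : HasParity l ψ) (hψt : IsTensorial R ψ) (hα : IsTensorial R α) :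
    lieC D C k φ (insC ψ α) - (-1 : ℤ) ^ (k * (l + 1)) • insC ψ (lieC D C k φ α) =
      insC (lieC D D k φ ψ - (-1 : ℤ) ^ (k * l) • lieC D D l ψ φ) α
        - (-1 : ℤ) ^ (k * (l + 1)) • lieC D C (k + l + 1) (insC ψ φ) α := by
  have hpar : HasParity (k + l + 1) (insC ψ φ) :=
    (hψ.insC hφ hφt.contr_zero_left).congr (by grind)
  have h₁ := covDerAlong_insC D C hφ hφt hψ hψt hα
  have h₂ := hα.insC_insC (hφ.dC D D hφt) (isTensorial_dC D D hφt).contr_add_left hψ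
    hψt.contr_add_left
  rw [lieC_eq D C hφ hφt (hα.insC hψt), lieC_eq D C hφ hφt hα, lieC_eq D D hφ hφt hψt,
    lieC_eq D C hpar (hφt.insC hψt) hα, lieC]
  simp only [insC_add_right, insC_zsmul_right, hα.insC_sub_left, hα.insC_add_left,
    hα.insC_zsmul_left]
  rw [sub_eq_iff_eq_add] at h₁ h₂
  rw [h₁, h₂]
  rcases neg_one_pow_eq_or ℤ k with hk | hk <;> rcases neg_one_pow_eq_or ℤ l with hl | hl <;>
    simp [pow_add, add_mul, mul_add, pow_mul, hk, hl] <;> abel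

/-- For a torsion-free connection on the arguments, `d = ∇_{id}` is the Koszul-type expression
`∑ ± ∇_{Z_i} ∘ α - i_{[,]} α`. -/
theorem dC_eq_of_torsionFree (br : L → L → L) (hbr : ∀ X Y, D.nabla X Y - D.nabla Y X = br X Y)
    (hα : IsTensorial R α) :
    dC D C α = (deg1 id ⊼ fun X => mapC (C.nabla X) α)
      - insC (Pi.single 2 fun Z => br (Z 0) (Z 1)) α := by
  have hτ : (deg1 id ⊼ fun X => deg1 (D.nabla X)) =
      (Pi.single 2 fun Z => br (Z 0) (Z 1) : Multi L L) := by
    have hadd : ∀ X Y, deg1 (D.nabla (X + Y)) = deg1 (D.nabla X) + deg1 (D.nabla Y) :=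
      fun X Y => by rw [D.add_left]; exact deg1_add _ _
    have hc : ∀ X, contr X (deg1 id ⊼ fun X => deg1 (D.nabla X)) =
        deg1 (fun Y => D.nabla X Y - D.nabla Y X) := fun X => by
      have h0 : deg1 (D.nabla 0) = 0 := by simpa using hadd 0 0
      have h1 : mapC (fun Y => D.nabla Y X) (deg1 id) = deg1 fun Y => D.nabla Y X := by
        have h2 : D.nabla 0 = 0 := by simpa using D.add_left 0 0
        funext m Z
        rcases eq_or_ne m 1 with rfl | hm
        · simp [mapC, deg1]
        · simp [mapC, deg1, Pi.single_eq_of_ne hm, h2]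
      rw [contr_wedge, contr_deg1, deg0_wedge _ h0, gradeInv_deg1]
      simp only [contr_deg1]
      rw [neg_wedge, wedge_deg0, h1, ← sub_eq_add_neg, deg1, deg1, ← Pi.single_sub]
      · rfl
      · intro Y W
        rw [D.add_left, deg0, deg0, deg0, ← Pi.single_add]
        rfl
    funext m Z
    cases m with
    | zero => simp [wedge_apply_zero, deg1]
    | succ m =>
      rw [succ_eq_contr (_ ⊼ _), succ_eq_contr (Pi.single _ _), hc, contr_single_succ]
      simp only [hbr]
      rfl
  have h : (deg1 id ⊼ fun X => insC (deg1 (D.nabla X)) α) =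
      insC (Pi.single 2 fun Z => br (Z 0) (Z 1)) α := by
    rw [← hτ]
    exact wedge_assoc _ _ hα.contr_add_left
      fun X Y => by rw [D.add_left]; exact deg1_add _ _
  rw [dC, covDerAlong, ← h, ← wedge_sub]
  rfl

end Connections
/-! ### Shuffles -/

section Shuffles

theorem mem_shuffles {p m : ℕ} {σ : Equiv.Perm (Fin m)} : σ ∈ shuffles p m ↔
    (∀ i j : Fin m, i < j → (j : ℕ) < p → σ i < σ j) ∧
      ∀ i j : Fin m, i < j → p ≤ (i : ℕ) → σ i < σ j := by
  simp only [shuffles, Finset.mem_filter, Finset.mem_univ, true_and]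
  constructor
  · rintro ⟨h, h'⟩
    exact ⟨fun i j hij hj => h (lt_trans (Fin.lt_def.1 hij) hj) hj hij,
      fun i j hij hi => h' hi (le_trans hi (Fin.lt_def.1 hij).le) hij⟩
  · rintro ⟨h, h'⟩
    exact ⟨fun i _ j hj hij => h i j hij hj, fun i hi j _ hij => h' i j hij hi⟩

/-- The permutation of `m + 1` letters which fixes `0` and acts as `τ` on the others. -/
def liftPerm {m : ℕ} (τ : Equiv.Perm (Fin m)) : Equiv.Perm (Fin (m + 1)) :=
  Equiv.Perm.decomposeFin.symm (0, τ)

@[simp] theorem liftPerm_zero {m : ℕ} (τ : Equiv.Perm (Fin m)) : liftPerm τ 0 = 0 := by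
  simp [liftPerm]

@[simp] theorem liftPerm_succ {m : ℕ} (τ : Equiv.Perm (Fin m)) (i : Fin m) :
    liftPerm τ i.succ = (τ i).succ := by
  simp [liftPerm]

theorem sign_liftPerm {m : ℕ} (τ : Equiv.Perm (Fin m)) :
    Equiv.Perm.sign (liftPerm τ) = Equiv.Perm.sign τ := by
  simp [liftPerm]

theorem liftPerm_injective (m : ℕ) : Function.Injective (liftPerm (m := m)) := fun σ τ h => by
  simpa using Equiv.Perm.decomposeFin.symm.injective h

theorem exists_eq_liftPerm {m : ℕ} {σ : Equiv.Perm (Fin (m + 1))} (h : σ 0 = 0) :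
    ∃ τ, σ = liftPerm τ := by
  obtain ⟨⟨i, τ⟩, rfl⟩ := Equiv.Perm.decomposeFin.symm.surjective σ
  rw [Equiv.Perm.decomposeFin_symm_apply_zero] at h
  exact ⟨τ, by rw [liftPerm, h]⟩

theorem shuffles_zero (m : ℕ) : shuffles 0 m = {1} := by
  ext σ
  rw [mem_shuffles, Finset.mem_singleton]
  constructor
  · rintro ⟨-, h⟩
    have hσ : StrictMono σ := fun i j hij => h i j hij (Nat.zero_le _)
    exact Equiv.coe_fn_injective ((hσ.range_inj strictMono_id).1 (by simp))
  · rintro rfl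
    exact ⟨fun i j hij _ => hij, fun i j hij _ => hij⟩

theorem liftPerm_mem_shuffles {p m : ℕ} {τ : Equiv.Perm (Fin m)} :
    liftPerm τ ∈ shuffles (p + 1) (m + 1) ↔ τ ∈ shuffles p m := by
  simp only [mem_shuffles]
  constructor
  · rintro ⟨h, h'⟩
    refine ⟨fun i j hij hj => ?_, fun i j hij hi => ?_⟩
    · simpa using h i.succ j.succ (by simpa using hij) (by simpa using hj)
    · simpa using h' i.succ j.succ (by simpa using hij) (by simpa using hi)
  · rintro ⟨h, h'⟩
    refine ⟨fun i j hij hj => ?_, fun i j hij hi => ?_⟩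
    · cases j using Fin.cases with
      | zero => exact absurd hij (Fin.not_lt_zero i)
      | succ j =>
      cases i using Fin.cases with
      | zero => simp
      | succ i => simpa using h i j (by simpa using hij) (by simpa using hj)
    · cases j using Fin.cases with
      | zero => exact absurd hij (Fin.not_lt_zero i)
      | succ j =>
      cases i using Fin.cases with
      | zero => simp
      | succ i => simpa using h' i j (by simpa using hij) (by simpa using hi)

/-- The permutation `σ` with `σ a = 0` which acts as `τ` from the letters other than `a` to the
letters other than `0`. -/
def insertPerm {m : ℕ} (a : Fin (m + 1)) (τ : Equiv.Perm (Fin m)) : Equiv.Perm (Fin (m + 1)) :=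
  liftPerm τ * a.cycleRange

@[simp] theorem insertPerm_self {m : ℕ} (a : Fin (m + 1)) (τ : Equiv.Perm (Fin m)) :
    insertPerm a τ a = 0 := by
  simp [insertPerm]

@[simp] theorem insertPerm_succAbove {m : ℕ} (a : Fin (m + 1)) (τ : Equiv.Perm (Fin m))
    (i : Fin m) : insertPerm a τ (a.succAbove i) = (τ i).succ := by
  simp [insertPerm]

theorem sign_insertPerm {m : ℕ} (a : Fin (m + 1)) (τ : Equiv.Perm (Fin m)) :
    Equiv.Perm.sign (insertPerm a τ) = (-1) ^ (a : ℕ) * Equiv.Perm.sign τ := by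
  rw [insertPerm, Equiv.Perm.sign_mul, sign_liftPerm, Fin.sign_cycleRange, mul_comm]

theorem exists_eq_insertPerm {m : ℕ} {a : Fin (m + 1)} {σ : Equiv.Perm (Fin (m + 1))}
    (h : σ a = 0) : ∃ τ, σ = insertPerm a τ := by
  obtain ⟨τ, hτ⟩ := exists_eq_liftPerm (σ := σ * a.cycleRange⁻¹) (by
    have : a.cycleRange⁻¹ 0 = a := by rw [Equiv.Perm.inv_eq_iff_eq, Fin.cycleRange_self]
    rw [Equiv.Perm.mul_apply, this, h])
  exact ⟨τ, by rw [insertPerm, ← hτ, inv_mul_cancel_right]⟩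

theorem insertPerm_mem_shuffles {p m : ℕ} (hp : p < m + 1) {τ : Equiv.Perm (Fin m)} :
    insertPerm ⟨p, hp⟩ τ ∈ shuffles p (m + 1) ↔ τ ∈ shuffles p m := by
  set a : Fin (m + 1) := ⟨p, hp⟩ with ha
  have hval : ∀ i : Fin m, (a.succAbove i : ℕ) < p ↔ (i : ℕ) < p := fun i => by
    rw [Fin.succAbove]
    split_ifs with h <;> simp only [Fin.lt_def, Fin.val_castSucc, Fin.val_succ, ha] at h ⊢
    omega
  have hval' : ∀ i : Fin m, p ≤ (a.succAbove i : ℕ) ↔ p ≤ (i : ℕ) := fun i => by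
    simpa using (hval i).not
  have hlt : ∀ i j : Fin m, a.succAbove i < a.succAbove j ↔ i < j := fun i j =>
    (Fin.strictMono_succAbove a).lt_iff_lt
  simp only [mem_shuffles]
  constructor
  · rintro ⟨h, h'⟩
    refine ⟨fun i j hij hj => ?_, fun i j hij hi => ?_⟩
    · simpa using h _ _ ((hlt i j).2 hij) ((hval j).2 hj)
    · simpa using h' _ _ ((hlt i j).2 hij) ((hval' i).2 hi)
  · rintro ⟨h, h'⟩
    refine ⟨fun i j hij hj => ?_, fun i j hij hi => ?_⟩
    · rcases Fin.eq_self_or_eq_succAbove a j with rfl | ⟨j, rfl⟩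
      · exact absurd hj (lt_irrefl p)
      rcases Fin.eq_self_or_eq_succAbove a i with rfl | ⟨i, rfl⟩
      · exact absurd hj (Fin.lt_def.1 hij).not_gt
      simpa using h i j ((hlt i j).1 hij) ((hval j).1 hj)
    · rcases Fin.eq_self_or_eq_succAbove a j with rfl | ⟨j, rfl⟩
      · exact absurd hi (not_le.2 (Fin.lt_def.1 hij))
      rcases Fin.eq_self_or_eq_succAbove a i with rfl | ⟨i, rfl⟩
      · simp
      simpa using h' i j ((hlt i j).1 hij) ((hval' i).1 hi)

/-- The letter `0` is the image of the first letter of one of the two blocks. -/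
theorem shuffle_zero_mem {p m : ℕ} {σ : Equiv.Perm (Fin (m + 1))}
    (hσ : σ ∈ shuffles (p + 1) (m + 1)) :
    σ 0 = 0 ∨ ∃ h : p + 1 < m + 1, σ ⟨p + 1, h⟩ = 0 := by
  rw [mem_shuffles] at hσ
  obtain ⟨i, hi⟩ := σ.surjective 0
  by_cases h : (i : ℕ) < p + 1
  · left
    rcases (Fin.zero_le i).eq_or_lt with h0 | h0
    · rw [← h0] at hi
      exact hi
    · exact absurd (hi ▸ hσ.1 0 i h0 h) (Fin.not_lt_zero _)
  · right
    refine ⟨by omega, ?_⟩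
    rcases eq_or_ne (i : ℕ) (p + 1) with h0 | h0
    · rw [← hi]; congr 1; exact Fin.ext h0.symm
    · exact absurd (hi ▸ hσ.2 ⟨p + 1, by omega⟩ i (Fin.lt_def.2 (by simp; omega)) le_rfl)
        (Fin.not_lt_zero _)

theorem sum_shuffles_self {N : Type*} [AddCommMonoid N] (p : ℕ)
    (f : Equiv.Perm (Fin (p + 1)) → N) :
    ∑ σ ∈ shuffles (p + 1) (p + 1), f σ = ∑ τ ∈ shuffles p p, f (liftPerm τ) := by
  symm
  refine Finset.sum_bij (fun τ _ => liftPerm τ) (fun τ hτ => liftPerm_mem_shuffles.2 hτ)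
    (fun _ _ _ _ h => liftPerm_injective _ h) (fun σ hσ => ?_) fun _ _ => rfl
  rcases shuffle_zero_mem hσ with h | ⟨h, -⟩
  · obtain ⟨τ, rfl⟩ := exists_eq_liftPerm h
    exact ⟨τ, liftPerm_mem_shuffles.1 hσ, rfl⟩
  · omega

/-- Shuffles are classified recursively by the block which contains the preimage of `0`. -/
theorem sum_shuffles_succ {N : Type*} [AddCommMonoid N] {p m : ℕ} (h : p + 1 < m + 1)
    (f : Equiv.Perm (Fin (m + 1)) → N) :
    ∑ σ ∈ shuffles (p + 1) (m + 1), f σ = ∑ τ ∈ shuffles p m, f (liftPerm τ) +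
      ∑ τ ∈ shuffles (p + 1) m, f (insertPerm ⟨p + 1, h⟩ τ) := by
  rw [← Finset.sum_filter_add_sum_filter_not _ fun σ : Equiv.Perm (Fin (m + 1)) => σ 0 = 0]
  congr 1
  · symm
    refine Finset.sum_bij (fun τ _ => liftPerm τ) (fun τ hτ => ?_)
      (fun _ _ _ _ h => liftPerm_injective _ h) (fun σ hσ => ?_) fun _ _ => rfl
    · simpa [liftPerm_mem_shuffles] using hτ
    · rw [Finset.mem_filter] at hσ
      obtain ⟨τ, rfl⟩ := exists_eq_liftPerm hσ.2
      exact ⟨τ, liftPerm_mem_shuffles.1 hσ.1, rfl⟩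
  · symm
    refine Finset.sum_bij (fun τ _ => insertPerm ⟨p + 1, h⟩ τ) (fun τ hτ => ?_)
      (fun _ _ _ _ h => liftPerm_injective _ (mul_right_cancel h)) (fun σ hσ => ?_)
      fun _ _ => rfl
    · rw [Finset.mem_filter]
      refine ⟨(insertPerm_mem_shuffles h).2 hτ, fun h0 => ?_⟩
      have := (insertPerm ⟨p + 1, h⟩ τ).injective (h0.trans (insertPerm_self ⟨p + 1, h⟩ τ).symm)
      simp [Fin.ext_iff] at this
    · rw [Finset.mem_filter] at hσ
      obtain ⟨_, h0⟩ := (shuffle_zero_mem hσ.1).resolve_left hσ.2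
      obtain ⟨τ, rfl⟩ := exists_eq_insertPerm h0
      exact ⟨τ, (insertPerm_mem_shuffles h).1 hσ.1, rfl⟩

variable {L N P : Type*} [AddCommGroup N] [AddCommGroup P]

theorem wedge_single_of_lt {p m : ℕ} (h : m < p) (φ : (Fin p → L) → P) {β : P → Multi L N}
    (h0 : β 0 = 0) : (Pi.single p φ ⊼ β) m = 0 := by
  funext Z
  induction m generalizing p β with
  | zero =>
    rw [wedge_apply_zero, Pi.single_eq_of_ne (by omega)]
    simp [h0]
  | succ m ih =>
    obtain ⟨p, rfl⟩ : ∃ q, p = q + 1 := ⟨p - 1, by omega⟩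
    have : gradeInv (Pi.single (p + 1) φ : Multi L P) =
        Pi.single (p + 1) ((-1 : ℤ) ^ (p + 1) • φ) := by
      rw [gradeInv_single, Pi.single_smul]
    rw [wedge_apply_succ, contr_single_succ, this, ih (by omega) _ h0,
      ih (by omega) _ (by simp [h0])]
    simp

/-- The wedge product of a homogeneous cochain with a family of cochains, as a sum over
shuffles. -/
theorem wedge_single {p q m : ℕ} (h : p + q = m) (φ : (Fin p → L) → P) {β : P → Multi L N}
    (hβ : ∀ x y, β (x + y) = β x + β y) (Z : Fin m → L) :
    (Pi.single p φ ⊼ β) m Z = ∑ σ ∈ shuffles p m, Equiv.Perm.sign σ •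
      β (φ fun i : Fin p => Z (σ ⟨i, by omega⟩)) q fun j : Fin q => Z (σ ⟨p + j, by omega⟩) := by
  have h0 : β 0 = 0 := by simpa using hβ 0 0
  induction m generalizing p q β with
  | zero =>
    obtain ⟨rfl, rfl⟩ : p = 0 ∧ q = 0 := by omega
    rw [shuffles_zero, Finset.sum_singleton, Equiv.Perm.sign_one, one_smul, wedge_apply_zero,
      Pi.single_eq_same]
    congr!
  | succ m ih =>
    have hcβ : ∀ x y, contr (Z 0) (β (x + y)) = contr (Z 0) (β x) + contr (Z 0) (β y) :=
      fun x y => by rw [hβ, contr_add]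
    cases p with
    | zero =>
      obtain rfl : q = m + 1 := by omega
      have e : φ (fun i : Fin 0 => Z i.elim0) = φ Fin.elim0 := by
        congr 1; exact Subsingleton.elim _ _
      have hd : (Pi.single 0 φ : Multi L P) = deg0 (φ Fin.elim0) := by
        rw [deg0]
        congr 1
        funext Y
        congr 1
        exact Subsingleton.elim _ _
      rw [hd, deg0_wedge _ h0, shuffles_zero, Finset.sum_singleton, Equiv.Perm.sign_one, one_smul]
      congr! 2
      simp
    | succ p =>
    have hfirst : (Pi.single p (fun Y => φ (Fin.cons (Z 0) Y)) ⊼ β) m (Fin.tail Z) =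
        ∑ τ ∈ shuffles p m, Equiv.Perm.sign (liftPerm τ) •
          β (φ fun i : Fin (p + 1) => Z (liftPerm τ ⟨i, by omega⟩)) q
            fun j : Fin q => Z (liftPerm τ ⟨p + 1 + j, by omega⟩) := by
      rw [ih (q := q) (by omega) _ hβ _ h0]
      refine Finset.sum_congr rfl fun τ _ => ?_
      rw [sign_liftPerm]
      congr 2
      · congr 2
        funext i
        cases i using Fin.cases with
        | zero => exact congrArg Z (liftPerm_zero τ).symm
        | succ i => exact congrArg Z (liftPerm_succ τ ⟨i, by omega⟩).symm
      · funext j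
        have : (⟨p + 1 + j, by omega⟩ : Fin (m + 1)) = (⟨p + j, by omega⟩ : Fin m).succ :=
          Fin.ext (by simp; omega)
        rw [this, liftPerm_succ]
        rfl
    rw [wedge_apply_succ, contr_single_succ, gradeInv_single,
      zsmul_wedge _ _ (β := fun x => contr (Z 0) (β x)) hcβ, hfirst]
    cases q with
    | zero =>
      obtain rfl : p = m := by omega
      rw [sum_shuffles_self, Pi.smul_apply, wedge_single_of_lt (Nat.lt_succ_self p) φ
        (β := fun x => contr (Z 0) (β x)) (by simp [h0])]
      simp
    | succ q =>
      rw [sum_shuffles_succ (by omega)]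
      congr 1
      rw [Pi.smul_apply, Pi.smul_apply, ih (q := q) (by omega) φ hcβ _ (by simp [h0]),
        Finset.smul_sum]
      refine Finset.sum_congr rfl fun τ _ => ?_
      have ha : p + 1 < m + 1 := by omega
      rw [sign_insertPerm, mul_smul, contr]
      have hsign : ∀ x : N, ((-1 : ℤˣ) ^ (p + 1)) • x = ((-1 : ℤ) ^ (p + 1)) • x := fun x => by
        rw [Units.smul_def]; simp
      rw [hsign]
      congr 3
      · congr 2
        funext i
        have : (⟨i, by omega⟩ : Fin (m + 1)) =
            (⟨p + 1, ha⟩ : Fin (m + 1)).succAbove ⟨i, by omega⟩ := by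
          exact (Fin.succAbove_of_castSucc_lt (⟨p + 1, ha⟩ : Fin (m + 1)) ⟨i, by omega⟩ i.2).symm
        rw [this, insertPerm_succAbove]
        rfl
      · funext j
        cases j using Fin.cases with
        | zero => exact congrArg Z (insertPerm_self ⟨p + 1, ha⟩ τ).symm
        | succ j =>
          have : (⟨p + 1 + j.succ, by simp; omega⟩ : Fin (m + 1)) =
              (⟨p + 1, ha⟩ : Fin (m + 1)).succAbove ⟨p + 1 + j, by omega⟩ := by
            rw [Fin.succAbove_of_le_castSucc _ _ (Fin.le_def.2 (by simp))]; rfl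
          rw [this, insertPerm_succAbove]
          rfl

end Shuffles
/-! ### Sections as a module over the smooth functions -/

section Geometry

variable {E : Type*} [NormedAddCommGroup E] [NormedSpace ℝ E]
  {H : Type*} [TopologicalSpace H] {I : ModelWithCorners ℝ E H}
  {M : Type*} [TopologicalSpace M] [ChartedSpace H M]
  {F : Type*} [NormedAddCommGroup F] [NormedSpace ℝ F]
  {V : M → Type*} [TopologicalSpace (TotalSpace F V)] [∀ x, TopologicalSpace (V x)]
  [FiberBundle F V] [∀ x, AddCommGroup (V x)] [∀ x, Module ℝ (V x)]
  {G : Type*} [NormedAddCommGroup G] [NormedSpace ℝ G]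
  {W : M → Type*} [TopologicalSpace (TotalSpace G W)] [∀ x, TopologicalSpace (W x)]
  [FiberBundle G W] [∀ x, AddCommGroup (W x)] [∀ x, Module ℝ (W x)]

/-- The sections of a vector bundle form a module over the smooth functions. -/
instance secModule [VectorBundle ℝ F V] : Module C^∞⟮I, M; ℝ⟯ (Sec I F V) where
  smul := fsmul
  one_smul s := by ext x; exact one_smul ℝ (s x)
  mul_smul f g s := by ext x; exact mul_smul (f x) (g x) (s x)
  smul_zero f := by ext x; exact smul_zero (f x)
  smul_add f s t := by ext x; exact smul_add (f x) (s x) (t x)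
  add_smul f g s := by ext x; exact add_smul (f x) (g x) (s x)
  zero_smul s := by ext x; exact zero_smul ℝ (s x)

theorem smul_sec_apply [VectorBundle ℝ F V] (f : C^∞⟮I, M; ℝ⟯) (s : Sec I F V) (x : M) :
    (f • s) x = f x • s x := rfl

theorem sum_sec_apply [VectorBundle ℝ F V] {ι : Type*} (t : Finset ι) (s : ι → Sec I F V) (x : M) :
    (∑ i ∈ t, s i) x = ∑ i ∈ t, s i x := by
  exact (congrFun (map_sum (ContMDiffSection.coeAddHom I F ∞ V) s t) x).trans (Finset.sum_apply ..)

/-- Near any point, sections are combinations of finitely many global sections with coefficients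
that are smooth fibrewise linear functionals. The cut-off function `f` enters twice, once to extend
the frame and once to extend the coefficients. -/
theorem exists_cutoff_frame [VectorBundle ℝ F V] [FiniteDimensional ℝ E] [T2Space M]
    [IsManifold I ∞ M] [FiniteDimensional ℝ F] [ContMDiffVectorBundle ∞ F V I] (x₀ : M) :
    ∃ (n : ℕ) (f : C^∞⟮I, M; ℝ⟯) (s : Fin n → Sec I F V) (c : Fin n → ∀ x, V x →ₗ[ℝ] ℝ),
      f x₀ = 1 ∧ (∀ i (Z : Sec I F V), ContMDiff I 𝓘(ℝ, ℝ) ∞ fun x => c i x (Z x)) ∧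
      ∀ x (v : V x), f x ^ 2 • v = ∑ i, c i x v • s i x := by
  have : ContMDiffVectorBundle 1 F V I := ContMDiffVectorBundle.of_le (n := ∞) (by norm_cast)
  let e := trivializationAt F V x₀
  let b := Module.finBasis ℝ F
  obtain ⟨f, -, hf⟩ := (SmoothBumpFunction.nhds_basis_tsupport (I := I) x₀).mem_iff.1
    (e.open_baseSet.mem_nhds (FiberBundle.mem_baseSet_trivializationAt F V x₀))
  refine ⟨_, ⟨f, f.contMDiff⟩, fun i => ⟨fun x => f x • e.localFrame b i x, ?_⟩,
    fun i x => f x • e.localFrameCoeff I b i x, f.eq_one, fun i Z => ?_, fun x v => ?_⟩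
  · exact f.contMDiff.contMDiffOn.smul_section_of_tsupport e.open_baseSet hf
      (e.contMDiffOn_localFrame_baseSet ∞ b i)
  · refine contMDiff_of_tsupport fun x hx => ?_
    have hx' : x ∈ e.baseSet := hf (tsupport_smul_subset_left f _ hx)
    exact f.contMDiffAt.smul (contMDiffAt_localFrameCoeff b hx' Z.contMDiff.contMDiffAt i)
  · change f x ^ 2 • v = ∑ i, (f x • e.localFrameCoeff I b i x v) • f x • e.localFrame b i x
    by_cases hx : x ∈ e.baseSet
    · classical
      have h := e.eq_sum_localFrameCoeff_smul (I := I) (b := b)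
        (s := Function.update (0 : ∀ y, V y) x v) hx
      rw [Function.update_self] at h
      conv_lhs => rw [h]
      rw [Finset.smul_sum]
      refine Finset.sum_congr rfl fun i _ => ?_
      rw [smul_smul, smul_smul]
      congr 1
      simp only [smul_eq_mul]
      ring
    · have : f x = 0 := image_eq_zero_of_notMem_tsupport fun h => hx (hf h)
      simp [this]

/-- A `C^∞(M)`-linear operator on sections is determined at `x` by the value of the section at
`x`. -/
theorem linearMap_apply_eq_zero [VectorBundle ℝ F V] [VectorBundle ℝ G W] [FiniteDimensional ℝ E]
    [T2Space M] [IsManifold I ∞ M] [FiniteDimensional ℝ F] [ContMDiffVectorBundle ∞ F V I]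
    (T : Sec I F V →ₗ[C^∞⟮I, M; ℝ⟯] Sec I G W) {x : M} {Z : Sec I F V} (hZ : Z x = 0) :
    T Z x = 0 := by
  obtain ⟨n, f, s, c, hf, hc, hs⟩ := exists_cutoff_frame (I := I) (F := F) (V := V) x
  let g : Fin n → C^∞⟮I, M; ℝ⟯ := fun i => ⟨_, hc i Z⟩
  have h : f ^ 2 • Z = ∑ i, g i • s i := by
    ext y
    rw [sum_sec_apply]
    exact hs y (Z y)
  have h' : (T (f ^ 2 • Z)) x = T Z x := by
    rw [map_smul, smul_sec_apply]
    change (f x) ^ 2 • _ = _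
    rw [hf, one_pow, one_smul]
  rw [← h', h, map_sum, sum_sec_apply]
  refine Finset.sum_eq_zero fun i _ => ?_
  rw [map_smul, smul_sec_apply]
  change c i x (Z x) • _ = _
  rw [hZ, map_zero, zero_smul]

theorem alternatingMap_apply_congr [VectorBundle ℝ F V] [VectorBundle ℝ G W]
    [FiniteDimensional ℝ E] [T2Space M] [IsManifold I ∞ M] [FiniteDimensional ℝ F]
    [ContMDiffVectorBundle ∞ F V I] {k : ℕ}
    (T : Sec I F V [⋀^Fin k]→ₗ[C^∞⟮I, M; ℝ⟯] Sec I G W) {x : M} {Z Z' : Fin k → Sec I F V}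
    (hZ : ∀ i, Z i x = Z' i x) : T Z x = T Z' x := by
  classical
  suffices h : ∀ t : Finset (Fin k), T (t.piecewise Z Z') x = T Z' x by simpa using h Finset.univ
  intro t
  induction t using Finset.induction_on with
  | empty => simp
  | insert i t hi ih =>
    rw [← ih, ← sub_eq_zero, Finset.piecewise_insert]
    have h := linearMap_apply_eq_zero (T.toMultilinearMap.toLinearMap (t.piecewise Z Z') i)
      (x := x) (Z := Z i - Z' i) (by simp [hZ])
    have h' : t.piecewise Z Z' = Function.update (t.piecewise Z Z') i (Z' i) := by
      rw [eq_comm, Function.update_eq_self_iff]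
      simp [hi]
    rw [map_sub] at h
    conv_lhs => rw [h']
    simpa using h

/-- A section through a given vector, chosen linearly in the vector. -/
theorem exists_extension [VectorBundle ℝ F V] [FiniteDimensional ℝ E] [T2Space M]
    [IsManifold I ∞ M] [FiniteDimensional ℝ F] [ContMDiffVectorBundle ∞ F V I] (x : M) :
    ∃ ext : V x →ₗ[ℝ] Sec I F V, ∀ v, ext v x = v := by
  obtain ⟨n, f, s, c, hf, -, hs⟩ := exists_cutoff_frame (I := I) (F := F) (V := V) x
  refine ⟨∑ i, (c i x).smulRight (s i), fun v => ?_⟩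
  rw [LinearMap.sum_apply, sum_sec_apply]
  have := hs x v
  rw [hf, one_pow, one_smul] at this
  exact this.symm

theorem Form.eval_injective [VectorBundle ℝ F V] [FiniteDimensional ℝ E] [T2Space M]
    [IsManifold I ∞ M] [FiniteDimensional ℝ F] [ContMDiffVectorBundle ∞ F V I] {k : ℕ} :
    Function.Injective (Form.eval : Form I F V G W k → Cochain I F V G W k) := by
  intro φ ψ h
  ext x v
  obtain ⟨ext, hext⟩ := exists_extension (I := I) (F := F) (V := V) x
  have := congrArg (fun s : Sec I G W => s x) (congrFun h fun i => ext (v i))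
  simpa [Form.eval, hext] using this

/-- The multilinear alternating map over the smooth functions which is given by a form. -/
def Form.toAlternatingMap [IsManifold I ∞ M] [VectorBundle ℝ F V] [VectorBundle ℝ G W] {k : ℕ}
    (φ : Form I F V G W k) : Sec I F V [⋀^Fin k]→ₗ[C^∞⟮I, M; ℝ⟯] Sec I G W where
  toFun := φ.eval
  map_update_add' Z i X Y := by
    ext x
    have h : ∀ X : Sec I F V, (fun j => Function.update Z i X j x) =
        Function.update (fun j => Z j x) i (X x) := fun X => by
      funext j
      rcases eq_or_ne j i with rfl | hj
      · simp
      · simp [hj]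
    exact (congrArg (φ.toFun x) (h (X + Y))).trans
      (((φ.toFun x).map_update_add _ i (X x) (Y x)).trans
        (congrArg₂ (fun a b => φ.toFun x a + φ.toFun x b) (h X).symm (h Y).symm))
  map_update_smul' Z i f X := by
    ext x
    have h : ∀ X : Sec I F V, (fun j => Function.update Z i X j x) =
        Function.update (fun j => Z j x) i (X x) := fun X => by
      funext j
      rcases eq_or_ne j i with rfl | hj
      · simp
      · simp [hj]
    exact (congrArg (φ.toFun x) (h (f • X))).trans
      (((φ.toFun x).map_update_smul _ i (f x) (X x)).trans
        (congrArg (fun a => f x • φ.toFun x a) (h X).symm))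
  map_eq_zero_of_eq' Z i j hZ hij := by
    ext x
    exact (φ.toFun x).map_eq_zero_of_eq _ (congrArg (fun s : Sec I F V => s x) hZ) hij

theorem Form.isTensorial [IsManifold I ∞ M] [VectorBundle ℝ F V] [VectorBundle ℝ G W] {k : ℕ}
    (φ : Form I F V G W k) :
    IsTensorial C^∞⟮I, M; ℝ⟯ (φ.toCochains : Multi (Sec I F V) (Sec I G W)) :=
  isTensorial_single φ.toAlternatingMap

/-- Tensoriality: every `C^∞(M)`-multilinear alternating map on sections is a form. -/
theorem exists_form_eval_eq [VectorBundle ℝ F V] [VectorBundle ℝ G W] [FiniteDimensional ℝ E]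
    [T2Space M] [IsManifold I ∞ M] [FiniteDimensional ℝ F] [ContMDiffVectorBundle ∞ F V I] {k : ℕ}
    (T : Sec I F V [⋀^Fin k]→ₗ[C^∞⟮I, M; ℝ⟯] Sec I G W) :
    ∃ χ : Form I F V G W k, χ.eval = T := by
  choose ext hext using fun x => exists_extension (I := I) (F := F) (V := V) x
  have hsmul : ∀ (a : ℝ) (s : Sec I F V),
      a • s = (ContMDiffMap.const a : C^∞⟮I, M; ℝ⟯) • s := fun a s => rfl
  have hev : ∀ (x : M) (Z : Fin k → Sec I F V), T (fun i => ext x (Z i x)) x = T Z x :=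
    fun x Z => alternatingMap_apply_congr T fun i => hext x (Z i x)
  refine ⟨⟨fun x =>
    { toFun := fun v => T (fun i => ext x (v i)) x
      map_update_add' := ?_
      map_update_smul' := ?_
      map_eq_zero_of_eq' := ?_ }, fun Z => ?_⟩, ?_⟩
  · intro hd v i a b
    have h : ∀ a, (fun j => ext x (Function.update v i a j)) =
        Function.update (fun j => ext x (v j)) i (ext x a) := fun a => by
      funext j
      rcases eq_or_ne j i with rfl | hj
      · simp
      · simp [hj]
    simp only [h, map_add, T.map_update_add]
    rfl
  · intro hd v i r a
    have h : ∀ a, (fun j => ext x (Function.update v i a j)) =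
        Function.update (fun j => ext x (v j)) i (ext x a) := fun a => by
      funext j
      rcases eq_or_ne j i with rfl | hj
      · simp
      · simp [hj]
    rw [h, map_smul, hsmul, T.map_update_smul, h]
    rfl
  · intro v i j hv hij
    have : T (fun i => ext x (v i)) = 0 := T.map_eq_zero_of_eq _ (by rw [hv]) hij
    exact congrArg (fun s : Sec I G W => s x) this
  · simp only [AlternatingMap.coe_mk, MultilinearMap.coe_mk]
    simpa only [hev] using (T Z).contMDiff
  · funext Z
    ext x
    exact hev x Z

/-- The `1`-forms separate the points of each fibre. -/
theorem exists_oneForm_ne_zero [VectorBundle ℝ F V] [FiniteDimensional ℝ E] [T2Space M]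
    [IsManifold I ∞ M] [FiniteDimensional ℝ F] [ContMDiffVectorBundle ∞ F V I] {x : M} {v : V x}
    (hv : v ≠ 0) : ∃ α : Form I F V ℝ (Trivial M ℝ) 1, α.toFun x (fun _ => v) ≠ 0 := by
  obtain ⟨n, f, s, c, hf, hc, hs⟩ := exists_cutoff_frame (I := I) (F := F) (V := V) x
  have h : ∃ i, c i x v ≠ 0 := by
    by_contra! h
    have := hs x v
    rw [hf, one_pow, one_smul] at this
    exact hv (this.trans (Finset.sum_eq_zero fun i _ => by rw [h, zero_smul]))
  obtain ⟨i, hi⟩ := h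
  refine ⟨⟨fun y => AlternatingMap.ofSubsingleton ℝ (V y) ℝ (0 : Fin 1) (c i y), fun Z y => ?_⟩, hi⟩
  exact (contMDiffAt_section y).2 (hc i (Z 0) y)

end Geometry
/-! ### The operators on forms in terms of the wedge product -/

section Operators

variable {E : Type*} [NormedAddCommGroup E] [NormedSpace ℝ E]
  {H : Type*} [TopologicalSpace H] {I : ModelWithCorners ℝ E H}
  {M : Type*} [TopologicalSpace M] [ChartedSpace H M]
  {F : Type*} [NormedAddCommGroup F] [NormedSpace ℝ F]
  {V : M → Type*} [TopologicalSpace (TotalSpace F V)] [∀ x, TopologicalSpace (V x)]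
  [FiberBundle F V]
  {G : Type*} [NormedAddCommGroup G] [NormedSpace ℝ G]
  {W : M → Type*} [TopologicalSpace (TotalSpace G W)] [∀ x, TopologicalSpace (W x)]
  [FiberBundle G W] [∀ x, AddCommGroup (W x)] [∀ x, Module ℝ (W x)] [VectorBundle ℝ G W]

theorem ins_apply_eq_zero {p m : ℕ} (φ : Cochain I F V F V p) {ψ : Cochains I F V G W}
    (h : p ≤ m → ψ (m - p + 1) = 0) : ins φ ψ m = 0 := by
  funext Z
  rw [ins]
  split_ifs with hp
  · simp [h hp]
  · rfl

variable [∀ x, AddCommGroup (V x)] [∀ x, Module ℝ (V x)] [VectorBundle ℝ F V]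

theorem ins_eq_insC {p : ℕ} (φ : Cochain I F V F V p) {ψ : Cochains I F V G W}
    (hψ : IsTensorial C^∞⟮I, M; ℝ⟯ (ψ : Multi (Sec I F V) (Sec I G W))) :
    ins φ ψ = insC (Pi.single p φ) ψ := by
  funext m Z
  by_cases h : p ≤ m
  · rw [ins, dif_pos h, insC, wedge_single (q := m - p) (by omega) φ hψ.contr_add_left]
    rfl
  · rw [ins, dif_neg h, insC, wedge_single_of_lt (by omega) φ hψ.contr_zero_left]
    rfl

/-- The composition `i_ψ φ` is homogeneous. -/
theorem ins_toCochains {k l : ℕ} (φ : Form I F V F V k) (ψ : Form I F V F V l) :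
    ins ψ.eval φ.toCochains = Pi.single (k + l - 1) (ins ψ.eval φ.toCochains (k + l - 1)) := by
  funext m
  rcases eq_or_ne m (k + l - 1) with rfl | hm
  · simp
  · rw [Pi.single_eq_of_ne hm]
    exact ins_apply_eq_zero _ fun h => Pi.single_eq_of_ne (by omega) _

variable [IsManifold I ∞ M] {A : LieAlgebroid I F V}

/-- The algebraic connection underlying an `A`-connection. -/
def Connection.toModuleConnection (C : Connection A G W) :
    ModuleConnection C^∞⟮I, M; ℝ⟯ (Sec I F V) (Sec I G W) A.rho where
  nabla X := (C.nabla X).toAddMonoidHom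
  add_left X Y := by ext1 s; exact C.add_left X Y s
  smul_left := C.fsmul_left
  leibniz := C.leibniz

/-- For a torsion-free connection on the algebroid, `d^∇` is the antisymmetrization of `∇`. -/
theorem extDer_eq_dC {D : Connection A F V} (hD : D.TorsionFree) (C : Connection A G W)
    {ψ : Cochains I F V G W}
    (hψ : IsTensorial C^∞⟮I, M; ℝ⟯ (ψ : Multi (Sec I F V) (Sec I G W))) :
    extDer C ψ = dC D.toModuleConnection C.toModuleConnection ψ := by
  rw [dC_eq_of_torsionFree D.toModuleConnection C.toModuleConnection (fun X Y => A.bracket X Y) hD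
    hψ]
  have hadd : ∀ X Y : Sec I F V, mapC (C.toModuleConnection.nabla (X + Y)) ψ =
      mapC (C.toModuleConnection.nabla X) ψ + mapC (C.toModuleConnection.nabla Y) ψ := fun X Y => by
    funext k Z
    exact C.add_left X Y _
  have h0 : mapC (C.toModuleConnection.nabla 0) ψ = 0 := by simpa using hadd 0 0
  funext m Z
  rw [Pi.sub_apply, Pi.sub_apply]
  match m with
  | 0 =>
    rw [deg1, insC, wedge_single_of_lt (by omega) _ h0,
      wedge_single_of_lt (by omega) _ hψ.contr_zero_left]
    simp [extDer]
  | 1 =>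
    rw [insC, wedge_single_of_lt (m := 1) (by omega) _ hψ.contr_zero_left, deg1,
      wedge_single (p := 1) (q := 0) rfl _ hadd, sum_shuffles_self, shuffles_zero,
      Finset.sum_singleton, sign_liftPerm, Equiv.Perm.sign_one, one_smul, Pi.zero_apply, sub_zero]
    have e : (fun j : Fin 0 => Z (liftPerm 1 ⟨1 + j, by omega⟩)) = Fin.elim0 :=
      Subsingleton.elim _ _
    have e' : Z (liftPerm 1 0) = Z 0 := by rw [liftPerm_zero]
    exact (congrArg₂ (fun X Y => C.nabla X (ψ 0 Y)) e' e).symm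
  | p + 2 =>
    rw [insC, wedge_single (p := 2) (q := p) (by omega) _ hψ.contr_add_left, deg1,
      wedge_single (p := 1) (q := p + 1) (by omega) _ hadd]
    refine congrArg₂ (· - ·) (Finset.sum_congr rfl fun σ _ => ?_)
      (Finset.sum_congr rfl fun σ _ => ?_)
    · have e : (fun j : Fin (p + 1) => Z (σ ⟨1 + j, by omega⟩)) = fun j => Z (σ j.succ) :=
        funext fun j => congrArg (fun i => Z (σ i)) (Fin.ext (add_comm _ _))
      exact (congrArg (fun Y => Equiv.Perm.sign σ • C.nabla (Z (σ 0)) (ψ (p + 1) Y)) e).symm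
    · have e : (fun j : Fin p => Z (σ ⟨2 + j, by omega⟩)) = fun j => Z (σ j.succ.succ) :=
        funext fun j => congrArg (fun i => Z (σ i)) (Fin.ext (add_comm _ _))
      exact (congrArg (fun Y => Equiv.Perm.sign σ •
        ψ (p + 1) (Fin.cons (A.bracket (Z (σ 0)) (Z (σ 1))) Y)) e).symm

theorem covLie_eq_lieC {D : Connection A F V} (hD : D.TorsionFree) (C : Connection A G W) {k : ℕ}
    {φ : Cochain I F V F V k} {α : Cochains I F V G W}
    (hφ : IsTensorial C^∞⟮I, M; ℝ⟯ (Pi.single k φ : Multi (Sec I F V) (Sec I F V)))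
    (hα : IsTensorial C^∞⟮I, M; ℝ⟯ (α : Multi (Sec I F V) (Sec I G W))) :
    covLie C φ α =
      lieC D.toModuleConnection C.toModuleConnection k (Pi.single k φ) α := by
  have hs : (((k : ℤ) - 1) * 1).negOnePow = -((-1) ^ k : ℤˣ) := by
    rw [mul_one, Int.negOnePow_sub, Int.negOnePow_one, Int.negOnePow_def]
    simp
  rw [covLie, gradedComm, extDer_eq_dC hD C hα, ins_eq_insC φ hα,
    ins_eq_insC φ (isTensorial_dC _ _ hα), extDer_eq_dC hD C (hα.insC hφ), hs, lieC, Units.smul_def]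
  simp

theorem extDer_apply_succ_eq_zero {C : Connection A G W} {m : ℕ} {ψ : Cochains I F V G W}
    (h : ψ m = 0) : extDer C ψ (m + 1) = 0 := by
  funext Z
  cases m <;> simp [extDer, h]

theorem covLie_toCochains_apply_eq_zero {C : Connection A G W} {k l m : ℕ} (hm : m ≠ k + l)
    (φ : Cochain I F V F V k) (ψ : Form I F V G W l) : covLie C φ ψ.toCochains m = 0 := by
  have h₁ : ins φ (extDer C ψ.toCochains) m = 0 := ins_apply_eq_zero _ fun h =>
    extDer_apply_succ_eq_zero (Pi.single_eq_of_ne (by omega) _)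
  have h₂ : extDer C (ins φ ψ.toCochains) m = 0 := by
    cases m with
    | zero => rfl
    | succ m =>
      exact extDer_apply_succ_eq_zero (ins_apply_eq_zero _ fun h =>
        Pi.single_eq_of_ne (by omega) _)
  rw [covLie, gradedComm, Pi.sub_apply, Pi.smul_apply, h₁, h₂, smul_zero, sub_zero]

theorem lieC_zero_left {D : Connection A F V} (C : Connection A G W) (k : ℕ)
    {α : Cochains I F V G W}
    (hα : IsTensorial C^∞⟮I, M; ℝ⟯ (α : Multi (Sec I F V) (Sec I G W))) :
    lieC D.toModuleConnection C.toModuleConnection k 0 α = 0 := by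
  have h : ∀ β : Multi (Sec I F V) (Sec I G W), IsTensorial C^∞⟮I, M; ℝ⟯ β → insC 0 β = 0 :=
    fun β hβ => zero_wedge hβ.contr_zero_left
  rw [lieC, h _ (isTensorial_dC _ _ hα), h _ hα, dC, covDerAlong]
  simp only [covDer_zero_right, wedge_zero]
  simp

/-- The operator `i_χ` determines `χ`, because `i_χ α = α ∘ χ` for `1`-forms `α`. -/
theorem Form.eq_of_ins_eq [FiniteDimensional ℝ E] [T2Space M] [FiniteDimensional ℝ F]
    [ContMDiffVectorBundle ∞ F V I] {k : ℕ} {χ χ' : Form I F V F V k}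
    (h : ∀ α : Form I F V ℝ (Trivial M ℝ) 1,
      ins χ.eval α.toCochains = ins χ'.eval α.toCochains) : χ = χ' := by
  have key : ∀ (χ : Form I F V F V k) (α : Form I F V ℝ (Trivial M ℝ) 1) (Z : Fin k → Sec I F V),
      ins χ.eval α.toCochains k Z = α.eval fun _ => χ.eval Z := by
    intro χ α Z
    rw [ins_eq_insC _ α.isTensorial, insC]
    have : ∀ X, contr X (α.toCochains : Multi (Sec I F V) (Sec I ℝ (Trivial M ℝ))) =
        deg0 (α.eval fun _ => X) := fun X => by
      rw [Form.toCochains, contr_single_succ, deg0]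
      congr 1
      funext Y
      congr 1
      funext i
      obtain rfl : i = 0 := Fin.eq_zero i
      rfl
    simp only [this]
    rw [wedge_deg0 _ fun X => α.eval fun _ => X, mapC, Pi.single_eq_same]
  refine Form.eval_injective ?_
  funext Z
  ext x
  by_contra hne
  obtain ⟨α, hα⟩ := exists_oneForm_ne_zero (I := I) (F := F) (sub_ne_zero.2 hne)
  have h' : (α.eval fun _ => χ.eval Z) = α.eval fun _ => χ'.eval Z := by
    rw [← key, ← key, h]
  have h'' : α.toFun x (fun _ => χ.eval Z x) = α.toFun x (fun _ => χ'.eval Z x) :=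
    congrArg (fun s : Sec I ℝ (Trivial M ℝ) => s x) h'
  refine hα ?_
  have hsub := (α.toFun x).map_update_sub (fun _ => 0) 0 (χ.eval Z x) (χ'.eval Z x)
  have hc : ∀ v : V x, Function.update (fun _ : Fin 1 => (0 : V x)) 0 v = fun _ => v := fun v => by
    funext i
    obtain rfl : i = 0 := Fin.eq_zero i
    simp
  rw [hc, hc, hc] at hsub
  rw [hsub, h'', sub_self]

/-- The form `L^∇_φ ψ - (-1)^{kl} L^∇_ψ φ`. It exists because this cochain is tensorial, although
the operators `L^∇` involve derivatives. -/
theorem exists_form_eq_covLie [FiniteDimensional ℝ E] [T2Space M] [FiniteDimensional ℝ F]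
    [ContMDiffVectorBundle ∞ F V I] {D : Connection A F V} (hD : D.TorsionFree) {k l : ℕ}
    (φ : Form I F V F V k) (ψ : Form I F V F V l) :
    ∃ χ : Form I F V F V (k + l), χ.toCochains =
      covLie D φ.eval ψ.toCochains - (-1 : ℤ) ^ (k * l) • covLie D ψ.eval φ.toCochains := by
  set B := covLie D φ.eval ψ.toCochains - (-1 : ℤ) ^ (k * l) • covLie D ψ.eval φ.toCochains with hB
  have hBt : IsTensorial C^∞⟮I, M; ℝ⟯ (B : Multi (Sec I F V) (Sec I F V)) := by
    rw [hB, covLie_eq_lieC hD D φ.isTensorial ψ.isTensorial,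
      covLie_eq_lieC hD D ψ.isTensorial φ.isTensorial]
    exact (isTensorial_lieC _ _ _ φ.isTensorial ψ.isTensorial).sub
      ((isTensorial_lieC _ _ _ ψ.isTensorial φ.isTensorial).zsmul _)
  obtain ⟨T, hT⟩ := hBt.exists_alternatingMap (k + l)
  obtain ⟨χ, hχ⟩ := exists_form_eval_eq T
  refine ⟨χ, ?_⟩
  funext m
  rcases eq_or_ne m (k + l) with rfl | hm
  · rw [Form.toCochains, Pi.single_eq_same, hχ, hT]
  · rw [Form.toCochains, Pi.single_eq_of_ne hm, hB, Pi.sub_apply, Pi.smul_apply,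
      covLie_toCochains_apply_eq_zero hm, covLie_toCochains_apply_eq_zero (by omega), smul_zero,
      sub_zero]

/-- The Lie derivative along `i_ψ φ`, which has the parity of `k + l + 1`. -/
theorem covLie_ins_toCochains {D : Connection A F V} (hD : D.TorsionFree) (C : Connection A G W)
    {k l : ℕ} (φ : Form I F V F V k) (ψ : Form I F V F V l) {α : Cochains I F V G W}
    (hα : IsTensorial C^∞⟮I, M; ℝ⟯ (α : Multi (Sec I F V) (Sec I G W))) :
    covLie C (ins ψ.eval φ.toCochains (k + l - 1)) α =
      lieC D.toModuleConnection C.toModuleConnection (k + l + 1)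
        (insC ψ.toCochains φ.toCochains) α := by
  have hι : (Pi.single (k + l - 1) (ins ψ.eval φ.toCochains (k + l - 1)) :
      Multi (Sec I F V) (Sec I F V)) = insC ψ.toCochains φ.toCochains := by
    rw [← ins_toCochains, ins_eq_insC _ φ.isTensorial]
    rfl
  have hιt : IsTensorial C^∞⟮I, M; ℝ⟯ (Pi.single (k + l - 1)
      (ins ψ.eval φ.toCochains (k + l - 1)) : Multi (Sec I F V) (Sec I F V)) := by
    rw [hι]
    exact φ.isTensorial.insC ψ.isTensorial
  rw [covLie_eq_lieC hD _ hιt hα, hι]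
  rcases Nat.eq_zero_or_pos (k + l) with h | h
  · -- For two sections, `i_ψ φ` vanishes, so the truncated degree `k + l - 1` does no harm.
    have h0 : insC ψ.toCochains φ.toCochains = (0 : Multi (Sec I F V) (Sec I F V)) := by
      rw [← hι, ins_apply_eq_zero _ fun _ => Pi.single_eq_of_ne (by omega) _, Pi.single_zero]
    rw [h0, lieC_zero_left _ _ hα, lieC_zero_left _ _ hα]
  · obtain ⟨n, hn⟩ : ∃ n, k + l = n + 1 := ⟨k + l - 1, by omega⟩
    rw [lieC, lieC, hn]
    simp [pow_succ]

theorem isFNBracket_of_eq_covLie {D : Connection A F V} (hD : D.TorsionFree) {k l : ℕ}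
    {φ : Form I F V F V k} {ψ : Form I F V F V l} {χ : Form I F V F V (k + l)}
    (hχ : χ.toCochains =
      covLie D φ.eval ψ.toCochains - (-1 : ℤ) ^ (k * l) • covLie D ψ.eval φ.toCochains) :
    IsFNBracket A φ ψ χ := by
  intro q α
  have hφ := φ.isTensorial
  have hψ := ψ.isTensorial
  have hα := α.isTensorial
  have hs : ((k : ℤ) * ((l : ℤ) - 1)).negOnePow = ((-1) ^ (k * (l + 1)) : ℤˣ) := by
    have : (k : ℤ) * (l - 1) = ((k * (l + 1) : ℕ) : ℤ) - 2 * k := by push_cast; ring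
    rw [this, Int.negOnePow_sub, Int.negOnePow_two_mul, Int.negOnePow_def, zpow_natCast, mul_one]
  have hι : ∀ {p : ℕ} (η : Form I F V F V p) {β : Cochains I F V ℝ (Trivial M ℝ)},
      IsTensorial C^∞⟮I, M; ℝ⟯ (β : Multi (Sec I F V) (Sec I ℝ (Trivial M ℝ))) →
      ins η.eval β = insC η.toCochains β := fun η _ hβ => ins_eq_insC η.eval hβ
  have hL : ∀ {β : Cochains I F V ℝ (Trivial M ℝ)},
      IsTensorial C^∞⟮I, M; ℝ⟯ (β : Multi (Sec I F V) (Sec I ℝ (Trivial M ℝ))) →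
      covLie (Connection.ofAnchor A) φ.eval β = lieC D.toModuleConnection
        (Connection.ofAnchor A).toModuleConnection k φ.toCochains β :=
    fun hβ => covLie_eq_lieC hD _ hφ hβ
  have hmain := lieC_insC D.toModuleConnection (Connection.ofAnchor A).toModuleConnection
    (HasParity.single k φ.eval) hφ (HasParity.single l ψ.eval) hψ hα
  rw [covLie_eq_lieC hD D hφ hψ, covLie_eq_lieC hD D hψ hφ] at hχ
  rw [gradedComm, covLie_ins_toCochains hD _ φ ψ hα, hs, hι ψ hα, hL (hα.insC hψ), hL hα,
    hι ψ (isTensorial_lieC _ _ _ hφ hα), hι χ hα, hχ]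
  simp only [Units.smul_def, Units.val_pow_eq_pow_val, Units.val_neg, Units.val_one]
  exact hmain

theorem IsFNBracket.eq [FiniteDimensional ℝ E] [T2Space M] [FiniteDimensional ℝ F]
    [ContMDiffVectorBundle ∞ F V I] {k l : ℕ} {φ : Form I F V F V k} {ψ : Form I F V F V l}
    {χ χ' : Form I F V F V (k + l)} (h : IsFNBracket A φ ψ χ) (h' : IsFNBracket A φ ψ χ') :
    χ = χ' :=
  Form.eq_of_ins_eq fun α => sub_left_injective ((h 1 α).symm.trans (h' 1 α))

end Operators
end LieAlgd

end

theorem theorem3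
    {E : Type*} [NormedAddCommGroup E] [NormedSpace ℝ E] [FiniteDimensional ℝ E]
    {H : Type*} [TopologicalSpace H] {I : ModelWithCorners ℝ E H}
    {M : Type*} [TopologicalSpace M] [T2Space M] [ChartedSpace H M] [IsManifold I ∞ M]
    {F : Type*} [NormedAddCommGroup F] [NormedSpace ℝ F] [FiniteDimensional ℝ F]
    {V : M → Type*} [TopologicalSpace (TotalSpace F V)] [∀ x, TopologicalSpace (V x)]
    [FiberBundle F V] [∀ x, AddCommGroup (V x)] [∀ x, Module ℝ (V x)] [VectorBundle ℝ F V]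
    [ContMDiffVectorBundle ∞ F V I]
    (A : LieAlgd.LieAlgebroid I F V) (D : LieAlgd.Connection A F V) (hD : D.TorsionFree)
    {k l : ℕ} (φ : LieAlgd.Form I F V F V k) (ψ : LieAlgd.Form I F V F V l) :
    (∃! χ : LieAlgd.Form I F V F V (k + l), LieAlgd.IsFNBracket A φ ψ χ) ∧
    (LieAlgd.fnBracket A φ ψ).toCochains =
      LieAlgd.covLie D φ.eval ψ.toCochains
        - (-1 : ℤ) ^ (k * l) • LieAlgd.covLie D ψ.eval φ.toCochains := by
  obtain ⟨χ, hχ⟩ := LieAlgd.exists_form_eq_covLie hD φ ψ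
  have hFN := LieAlgd.isFNBracket_of_eq_covLie hD hχ
  have hex : ∃ χ, LieAlgd.IsFNBracket A φ ψ χ := ⟨χ, hFN⟩
  refine ⟨⟨χ, hFN, fun χ' h => h.eq hFN⟩, ?_⟩
  rw [LieAlgd.fnBracket, dif_pos hex, hex.choose_spec.eq hFN, hχ]
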